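/- **Conventions.** Let $A$ be a C*-algebra, unital or not. $\mathcal U(A)$ denotes the unitary group of $A$ (of $A+\mathbb C1$ if $A$ is non-unital), with the norm topology, and $\mathrm{Ad}\,u(x)=uxu^*$. For a state $\omega$ of $A$, $\pi_\omega$ is its GNS representation on $\mathcal H_\omega$, and $\mathcal K(\mathcal H_\omega)$ is the algebra of compact operators on $\mathcal H_\omega$. Pure states are the extreme points of the state space. Irreducible representations are nonzero. Representations $\pi_1,\pi_2$ are quasi-equivalent if there is a $*$-isomorphism $\theta$ of $\pi_1(A)''$ onto $\pi_2(A)''$ with $\theta(\pi_1(a))=\pi_2(a)$ for all $a\in A$. **Property A.** For any finite subset $\mathcal F$ of $A$, any pure state $\omega$ of $A$ with $\pi_\omega(A)\cap\mathcal K(\mathcal H_\omega)=(0)$, and any $\varepsilon>0$, there exist a finite subset $\mathcal G$ of $A$ and $\delta>0$ such that the following holds: if $\varphi$ is a pure state of $A$ such that $\pi_\varphi$ is quasi-equivalent to $\pi_\omega$ and $$|\varphi(x)-\omega(x)|<\delta,\qquad x\in\mathcal G,$$ then there is a continuous path $(u_t)_{t\in[0,1]}$ in $\mathcal U(A)$ such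 that $u_0=1$, $\varphi=\omega\circ\mathrm{Ad}\,u_1$, and $$\|\mathrm{Ad}\,u_t(x)-x\|<\varepsilon,\qquad x\in\mathcal F,\ t\in[0,1].$$ **Property B.** For any finite subset $\mathcal F$ of $A$, any irreducible representation $\pi$ of $A$ on a Hilbert space $\mathcal H$, any finite-dimensional projection $E$ on $\mathcal H$, and any $\varepsilon>0$, there exist $n$ and a row $x=(x_1,\dots,x_n)\in M_{1n}(A)$ such that, with $xx^*=\sum_i x_ix_i^*$, $$\|xx^*\|\le 1,\qquad \pi(xx^*)E=E,\qquad \|\mathrm{ad}\,a\circ\mathrm{Ad}\,x\|<\varepsilon\quad\text{for all }a\in\mathcal F,$$ where $\mathrm{Ad}\,x$ and $\mathrm{ad}\,a$ are the linear maps on $A$ given by $b\mapsto\sum_i x_ibx_i^*$ and $b\mapsto ab-ba$, and the norm is the operator norm of bounded linear maps on $A$. **Theorem 3.1.** Every C*-algebra with Property B has Property A. -/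

import Mathlib

open scoped ComplexOrder

/-! ### States and pure states -/

section States

variable {A : Type*} [NonUnitalCStarAlgebra A] [PartialOrder A] [StarOrderedRing A]

/-- A positive linear functional on a C⋆-algebra as a continuous linear functional
(positive functionals are automatically bounded). -/
noncomputable def posFunctionalToCLM (φ : A →ₚ[ℂ] ℂ) : A →L[ℂ] ℂ :=
  ⟨φ.toLinearMap, map_continuous φ⟩

@[simp]
theorem posFunctionalToCLM_apply (φ : A →ₚ[ℂ] ℂ) (a : A) : posFunctionalToCLM φ a = φ a := rfl

variable (A) in
/-- The state space of `A`: positive linear functionals of norm one. -/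
def stateSpace : Set (A →L[ℂ] ℂ) :=
  {f | (∀ a : A, 0 ≤ a → 0 ≤ f a) ∧ ‖f‖ = 1}

/-- A pure state is an extreme point of the state space. -/
def IsPureState (φ : A →ₚ[ℂ] ℂ) : Prop :=
  posFunctionalToCLM φ ∈ Set.extremePoints ℝ (stateSpace A)

end States

/-! ### Representations -/

section Representations

variable {A : Type*} [NonUnitalCStarAlgebra A]

/-- A representation is (topologically) irreducible if it is nonzero and has no closed invariant
subspaces except the trivial ones. -/
def IsIrreducibleRep {H : Type*} [NormedAddCommGroup H] [InnerProductSpace ℂ H] [CompleteSpace H]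
    (π : A →⋆ₙₐ[ℂ] (H →L[ℂ] H)) : Prop :=
  (∃ a : A, π a ≠ 0) ∧
    ∀ K : Submodule ℂ H, IsClosed (K : Set H) → (∀ a : A, ∀ v ∈ K, π a v ∈ K) → K = ⊥ ∨ K = ⊤

/-- The von Neumann algebra `π(A)''` generated by a (nondegenerate) representation, as the double
commutant of its range. -/
noncomputable def bicommutant {H : Type*} [NormedAddCommGroup H] [InnerProductSpace ℂ H] [CompleteSpace H]
    (π : A →⋆ₙₐ[ℂ] (H →L[ℂ] H)) : StarSubalgebra ℂ (H →L[ℂ] H) :=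
  StarSubalgebra.centralizer ℂ
    (StarSubalgebra.centralizer ℂ (Set.range π) : Set (H →L[ℂ] H))

theorem mem_bicommutant {H : Type*} [NormedAddCommGroup H] [InnerProductSpace ℂ H]
    [CompleteSpace H] (π : A →⋆ₙₐ[ℂ] (H →L[ℂ] H)) (a : A) : π a ∈ bicommutant π := by
  rw [bicommutant, StarSubalgebra.mem_centralizer_iff]
  intro g hg
  have hg' := (StarSubalgebra.mem_centralizer_iff ℂ).1 hg (π a) ⟨a, rfl⟩
  exact ⟨hg'.1.symm, by rw [← star_star (π a), ← star_mul, ← star_mul, hg'.2]⟩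

/-- Two (nondegenerate) representations `π₁`, `π₂` are quasi-equivalent if there is a
`⋆`-isomorphism of `π₁(A)''` onto `π₂(A)''` which carries `π₁ a` to `π₂ a` for all `a`. -/
def QuasiEquivalent {H₁ H₂ : Type*}
    [NormedAddCommGroup H₁] [InnerProductSpace ℂ H₁] [CompleteSpace H₁]
    [NormedAddCommGroup H₂] [InnerProductSpace ℂ H₂] [CompleteSpace H₂]
    (π₁ : A →⋆ₙₐ[ℂ] (H₁ →L[ℂ] H₁)) (π₂ : A →⋆ₙₐ[ℂ] (H₂ →L[ℂ] H₂)) : Prop :=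
  ∃ θ : bicommutant π₁ ≃⋆ₐ[ℂ] bicommutant π₂,
    ∀ a : A, θ ⟨π₁ a, mem_bicommutant π₁ a⟩ = ⟨π₂ a, mem_bicommutant π₂ a⟩

end Representations

/-! ### Inner automorphisms -/

section Inner

/-- For a unitary `u` of `A + ℂ1`, the inner automorphism `Ad u : x ↦ u x u⋆` of `A`. The product
is computed in the unitization, in which `A` is an ideal, see `coe_unitaryAd`. -/
noncomputable def unitaryAd {A : Type*} [NonUnitalCStarAlgebra A]
    (u : unitary (Unitization ℂ A)) (x : A) : A :=
  ((u : Unitization ℂ A) * (x : Unitization ℂ A) * star (u : Unitization ℂ A)).snd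

theorem coe_unitaryAd {A : Type*} [NonUnitalCStarAlgebra A]
    (u : unitary (Unitization ℂ A)) (x : A) :
    ((unitaryAd u x : A) : Unitization ℂ A) =
      (u : Unitization ℂ A) * (x : Unitization ℂ A) * star (u : Unitization ℂ A) := by
  ext <;> simp [unitaryAd]

/-- If `A` is unital, then the norm-continuous paths, starting at `1`, of unitaries of the
unitization and of unitaries of `A` itself give the same paths of inner automorphisms of `A`. So
using the unitization for all `A` agrees with the convention that the unitary group of `A` lies in
`A` for unital `A` and in `A + ℂ1` for nonunital `A`. -/
theorem exists_unitary_path_iff {A : Type*} [CStarAlgebra A]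
    (P : (unitInterval → A → A) → Prop) :
    (∃ u : C(unitInterval, unitary (Unitization ℂ A)), u 0 = 1 ∧ P fun t => unitaryAd (u t)) ↔
      ∃ v : C(unitInterval, unitary A), v 0 = 1 ∧
        P fun t x => (v t : A) * x * star (v t : A) := by
  constructor
  · rintro ⟨u, hu, hP⟩
    let f : Unitization ℂ A → A := fun w => w.fst • (1 : A) + w.snd
    have hmul : ∀ w z, f w * f z = f (w * z) := by
      intro w z
      simp only [f, Unitization.fst_mul, Unitization.snd_mul, add_mul, mul_add, smul_mul_assoc,
        mul_smul_comm, one_mul, mul_one, mul_smul, smul_add]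
      rw [smul_comm w.fst z.fst]
      abel
    have hone : f 1 = 1 := by simp [f]
    have hstar : ∀ w, star (f w) = f (star w) := by
      intro w; simp [f]
    have hf : Continuous f :=
      (Unitization.continuous_fst.smul continuous_const).add Unitization.continuous_snd
    refine ⟨⟨fun t => ⟨f (u t), ?_, ?_⟩, ?_⟩, ?_, ?_⟩
    · rw [hstar, hmul, (Unitary.mem_iff.1 (u t).2).1, hone]
    · rw [hstar, hmul, (Unitary.mem_iff.1 (u t).2).2, hone]
    · exact (hf.comp (continuous_subtype_val.comp u.continuous)).subtype_mk _
    · ext1; simp [hu, hone]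
    · convert hP using 3 with t x
      have hinr : ∀ a : A, f (a : Unitization ℂ A) = a := by intro a; simp [f]
      have := congrArg f (coe_unitaryAd (u t) x)
      rw [← hmul, ← hmul, ← hstar, hinr, hinr] at this
      exact this.symm
  · rintro ⟨v, hv, hP⟩
    let g : A → Unitization ℂ A := fun a => 1 + Unitization.inr (a - 1)
    have hfst : ∀ a, (g a).fst = 1 := by
      intro a; simp only [g, Unitization.fst_add, Unitization.fst_one, Unitization.fst_inr, add_zero]
    have hsnd : ∀ a, (g a).snd = a - 1 := by
      intro a; simp only [g, Unitization.snd_add, Unitization.snd_one, Unitization.snd_inr, zero_add]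
    have hmul : ∀ a b, g a * g b = g (a * b) := by
      intro a b
      ext
      · simp [hfst]
      · simp only [Unitization.snd_mul, hfst, hsnd, one_smul, sub_mul, mul_sub, one_mul, mul_one]
        abel
    have hone : g 1 = 1 := by simp [g]
    have hstar : ∀ a, star (g a) = g (star a) := by
      intro a; ext <;> simp [hfst, hsnd]
    have hg : Continuous g := continuous_const.add
      ((Unitization.isometry_inr (𝕜 := ℂ)).continuous.comp (continuous_id.sub continuous_const))
    refine ⟨⟨fun t => ⟨g (v t), ?_, ?_⟩, ?_⟩, ?_, ?_⟩
    · rw [hstar, hmul, (Unitary.mem_iff.1 (v t).2).1, hone]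
    · rw [hstar, hmul, (Unitary.mem_iff.1 (v t).2).2, hone]
    · exact (hg.comp (continuous_subtype_val.comp v.continuous)).subtype_mk _
    · ext1; simp [hv, hone]
    · convert hP using 3 with t x
      simp [unitaryAd, hstar, hfst, hsnd, mul_assoc, sub_mul, mul_sub]

end Inner

/-! ### The two properties -/

section Properties

/-- The bounded linear map `ad a : b ↦ a b - b a` on `A`. -/
noncomputable def adMap {A : Type*} [NonUnitalCStarAlgebra A] (a : A) : A →L[ℂ] A :=
  ContinuousLinearMap.mul ℂ A a - (ContinuousLinearMap.mul ℂ A).flip a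

@[simp]
theorem adMap_apply {A : Type*} [NonUnitalCStarAlgebra A] (a b : A) :
    adMap a b = a * b - b * a := rfl

/-- For a row `x = (x₁, …, xₙ)` over `A`, the bounded linear map `Ad x : b ↦ ∑ i, xᵢ b xᵢ⋆`. -/
noncomputable def rowAd {A : Type*} [NonUnitalCStarAlgebra A] {n : ℕ} (x : Fin n → A) :
    A →L[ℂ] A :=
  ∑ i, (ContinuousLinearMap.mul ℂ A (x i)).comp ((ContinuousLinearMap.mul ℂ A).flip (star (x i)))

@[simp]
theorem rowAd_apply {A : Type*} [NonUnitalCStarAlgebra A] {n : ℕ} (x : Fin n → A) (b : A) :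
    rowAd x b = ∑ i, x i * b * star (x i) := by
  simp [rowAd, mul_assoc]

/-- Property A. -/
def PropertyA (A : Type*) [NonUnitalCStarAlgebra A] [PartialOrder A] [StarOrderedRing A] : Prop :=
  ∀ (F : Finset A) (ω : A →ₚ[ℂ] ℂ), IsPureState ω →
    -- the image of the GNS representation contains no nonzero compact operator
    (∀ a : A, IsCompactOperator (ω.gnsNonUnitalStarAlgHom a) → ω.gnsNonUnitalStarAlgHom a = 0) →
    ∀ ε : ℝ, 0 < ε →
      ∃ (G : Finset A) (δ : ℝ), 0 < δ ∧
        ∀ φ : A →ₚ[ℂ] ℂ, IsPureState φ →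
          QuasiEquivalent φ.gnsNonUnitalStarAlgHom ω.gnsNonUnitalStarAlgHom →
          (∀ x ∈ G, ‖φ x - ω x‖ < δ) →
          ∃ u : C(unitInterval, unitary (Unitization ℂ A)),
            u 0 = 1 ∧
            (∀ x : A, φ x = ω (unitaryAd (u 1) x)) ∧
            ∀ x ∈ F, ∀ t : unitInterval, ‖unitaryAd (u t) x - x‖ < ε

/-- Property B. An irreducible representation is cyclic, so up to unitary equivalence it acts on a
Hilbert space in the universe of `A`. -/
def PropertyB.{u} (A : Type u) [NonUnitalCStarAlgebra A] : Prop :=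
  ∀ (F : Finset A) (H : Type u) [NormedAddCommGroup H] [InnerProductSpace ℂ H] [CompleteSpace H]
    (π : A →⋆ₙₐ[ℂ] (H →L[ℂ] H)), IsIrreducibleRep π →
    ∀ E : H →L[ℂ] H, IsStarProjection E → FiniteDimensional ℂ E.range →
      ∀ ε : ℝ, 0 < ε →
        ∃ (n : ℕ) (x : Fin n → A),
          ‖∑ i, x i * star (x i)‖ ≤ 1 ∧
          π (∑ i, x i * star (x i)) * E = E ∧
          ∀ a ∈ F, ‖(adMap a).comp (rowAd x)‖ < ε

end Properties

/-! Let `π` be the GNS representation of `ω` and `Ω` its cyclic vector. A pure state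
quasi-equivalent to `ω` is the vector state of some unit vector `η` in the same space, so the task
is to move `Ω` to `η` along unitaries that almost commute with `F`.

Property B, applied to the projection onto `Ω`, gives a row `x` with `π(xx*)Ω = Ω` such that `rowAd
x h` almost commutes with `F` for every contraction `h`. This leaves `h` free. Let `G` consist of
the products `xᵢxⱼ*`. If the vectors `xᵢ*Ω` and `xᵢ*η` have nearly equal Gram matrices and are
nearly orthogonal to each other, then all `xᵢ*(Ω - η)` are nearly orthogonal to all `xⱼ*(Ω + η)`.
Kaplansky density provides a self-adjoint contraction `h` acting nearly as 1 on the former and as 0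
on the latter. Then `rowAd x h` nearly fixes `Ω - η` and nearly kills `Ω + η`, so the exponential of
`iπ` times it nearly swaps `Ω` and `η` (`exists_rowAd_swap`, `exists_exp_apply_sub_le`).

A general `η` need not be orthogonal to `Ω` in this sense. Since `π(A)` contains no nonzero compact
operator, Glimm's lemma (`exists_orthogonal_norm_sub_lt`) supplies an intermediate `ζ` with nearly
the same values on `G` and exactly orthogonal to both; swap `Ω` with `ζ`, then `ζ` with `η`. The
remaining small error is removed by a unitary close to 1, from a quantitative transitivity theorem
(`exists_unitary_apply_eq`). The path runs through the three exponentials simultaneously. -/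

open scoped InnerProductSpace

/-! ### Reducing subspaces. -/

section Invariant

variable {E : Type*} [NormedAddCommGroup E] [InnerProductSpace ℂ E] [CompleteSpace E]

/-- The projection onto a reducing subspace of `T` commutes with `T`. -/
theorem starProjection_apply_comm (K : Submodule ℂ E) [K.HasOrthogonalProjection] (T : E →L[ℂ] E)
    (h₁ : ∀ v ∈ K, T v ∈ K) (h₂ : ∀ v ∈ K, star T v ∈ K) (z : E) :
    K.starProjection (T z) = T (K.starProjection z) := by
  refine (Submodule.eq_starProjection_of_mem_orthogonal (h₁ _ (K.starProjection_apply_mem z)) ?_)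
  rw [← map_sub]
  intro v hv
  have := K.sub_starProjection_mem_orthogonal z _ (h₂ v hv)
  rwa [ContinuousLinearMap.star_eq_adjoint, ContinuousLinearMap.adjoint_inner_left] at this

end Invariant

/-! ### Functional calculus with `t ↦ 2t / (1 + t²)`. -/

section CFC

variable {B : Type*} [CStarAlgebra B]

/-- A self-adjoint contraction is of the form `2 T (1 + T²)⁻¹` with `T` self-adjoint. -/
theorem IsSelfAdjoint.exists_eq_two_mul_one_add_sq_inv {S : B} (hS : IsSelfAdjoint S)
    (hS1 : ‖S‖ ≤ 1) :
    ∃ T R : B, IsSelfAdjoint T ∧ R + T * (T * R) = 1 ∧ S = (2 : ℂ) • (T * R) := by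
  rcases subsingleton_or_nontrivial B with _ | _
  · exact ⟨0, 0, .zero _, Subsingleton.elim _ _, Subsingleton.elim _ _⟩
  -- `g` inverts `t ↦ 2t / (1 + t²)` on `[-1, 1]`. As `√` vanishes on negative reals, `g` is
  -- continuous on all of `ℝ`.
  let g : ℝ → ℝ := fun t => t / (1 + √(1 - t ^ 2))
  let r : ℝ → ℝ := fun t => (1 + g t ^ 2)⁻¹
  have hgc : Continuous g := by
    refine continuous_id.div (by fun_prop) fun t => ?_
    positivity
  have hrc : Continuous r := by
    refine Continuous.inv₀ (by fun_prop) fun t => ?_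
    positivity
  refine ⟨cfc g S, cfc r S, cfc_predicate g S, ?_, ?_⟩
  · rw [← cfc_mul g r S, ← cfc_mul g _ S, ← cfc_add S r _, ← cfc_const_one ℝ S]
    refine cfc_congr fun t _ => ?_
    have : (1 + g t ^ 2) ≠ 0 := by positivity
    simp only [r]
    field_simp
  · rw [← cfc_mul g r S, show (2 : ℂ) = ((2 : ℝ) : ℂ) by norm_num, Complex.coe_smul,
      ← cfc_smul (2 : ℝ) _ S]
    conv_lhs => rw [← cfc_id ℝ S]
    refine cfc_congr fun t ht => ?_
    have ht1 : |t| ≤ 1 := (spectrum.norm_le_norm_of_mem ht).trans hS1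
    have ht2 : 0 ≤ 1 - t ^ 2 := by rw [sub_nonneg]; exact (sq_le_one_iff_abs_le_one t).2 ht1
    have h3 := Real.sq_sqrt ht2
    have h4 := Real.sqrt_nonneg (1 - t ^ 2)
    simp only [r, g, id, smul_eq_mul]
    set y := √(1 - t ^ 2)
    have h5 : (1 + y) ≠ 0 := by positivity
    have h6 : (1 + y) ^ 2 + t ^ 2 ≠ 0 := by positivity
    field_simp
    linear_combination t * h3

/-- Isolates `Q = (1 + X²)⁻¹`, so that in the density theorem the function of `X` can be compared
with that of `T` by plain algebra. -/
theorem IsSelfAdjoint.exists_cfc_eq_two_mul {X : B} (hX : IsSelfAdjoint X) :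
    ∃ Q : B, ‖Q‖ ≤ 1 ∧ Q + Q * (X * X) = 1 ∧
      cfc (fun t : ℝ => 2 * t * (1 + t ^ 2)⁻¹) X = (2 : ℂ) • (Q * X) := by
  let q : ℝ → ℝ := fun t => (1 + t ^ 2)⁻¹
  have hqc : Continuous q := by
    refine Continuous.inv₀ (by fun_prop) fun t => ?_
    positivity
  refine ⟨cfc q X, norm_cfc_le zero_le_one fun t _ => ?_, ?_, ?_⟩
  · have : 0 ≤ (1 + t ^ 2)⁻¹ := by positivity
    rw [Real.norm_of_nonneg this]
    exact inv_le_one_of_one_le₀ (by nlinarith [sq_nonneg t])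
  · have h := cfc_id ℝ X
    nth_rw 3 4 [← h]
    rw [← cfc_mul id id X, ← cfc_mul q _ X, ← cfc_add X q _, ← cfc_const_one ℝ X]
    refine cfc_congr fun t _ => ?_
    have : (1 + t ^ 2) ≠ 0 := by positivity
    simp only [q, id]
    field_simp
  · have h := cfc_id ℝ X
    nth_rw 3 [← h]
    rw [← cfc_mul q id X, show (2 : ℂ) = ((2 : ℝ) : ℂ) by norm_num, Complex.coe_smul,
      ← cfc_smul (2 : ℝ) _ X]
    refine cfc_congr fun t _ => ?_
    simp only [q, id, smul_eq_mul]
    ring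

end CFC

/-! ### Schur's lemma and Kaplansky density. -/

section Density

variable {A : Type*} [NonUnitalCStarAlgebra A]
  {H : Type*} [NormedAddCommGroup H] [InnerProductSpace ℂ H] [CompleteSpace H]
  {π : A →⋆ₙₐ[ℂ] (H →L[ℂ] H)}

/-- Nondegeneracy, which is not automatic without a unit: the common kernel is a closed invariant
subspace, and it is not everything since `π ≠ 0`. -/
theorem IsIrreducibleRep.eq_zero_of_forall (hπ : IsIrreducibleRep π) {v : H}
    (hv : ∀ a, π a v = 0) : v = 0 := by
  let K : Submodule ℂ H := ⨅ a, LinearMap.ker (π a).toLinearMap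
  have hK : ∀ w, w ∈ K ↔ ∀ a, π a w = 0 := by intro w; simp [K]
  have hcl : IsClosed (K : Set H) := by
    have : (K : Set H) = ⋂ a, {w | π a w = 0} := by ext w; simp [hK]
    rw [this]
    exact isClosed_iInter fun a => isClosed_eq (π a).continuous continuous_const
  rcases hπ.2 K hcl (fun a w hw => (hK _).2 fun b => by
    rw [(hK w).1 hw a, map_zero]) with h | h
  · have : v ∈ K := (hK v).2 hv
    rwa [h, Submodule.mem_bot] at this
  · obtain ⟨a, ha⟩ := hπ.1
    refine absurd (ContinuousLinearMap.ext fun w => ?_) ha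
    have : w ∈ K := h ▸ Submodule.mem_top
    exact (hK w).1 this a

/-- Schur's lemma for self-adjoint operators. -/
theorem IsIrreducibleRep.exists_eq_smul_one_of_isSelfAdjoint (hπ : IsIrreducibleRep π)
    {T : H →L[ℂ] H} (hT : IsSelfAdjoint T) (hc : ∀ a, Commute (π a) T) :
    ∃ c : ℂ, T = c • 1 := by
  by_cases hs : (spectrum ℝ T).Subsingleton
  · rcases hs.eq_empty_or_singleton with h | ⟨c, h⟩
    · refine ⟨0, ?_⟩
      rw [← cfc_id ℝ T, cfc_congr (g := fun _ => (0 : ℝ)) (by rw [h]; exact fun x hx => hx.elim)]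
      simp
    · refine ⟨c, ?_⟩
      rw [← cfc_id ℝ T, cfc_congr (g := fun _ => (c : ℝ)) (by rw [h]; exact fun x hx => hx)]
      rw [cfc_const c T, Algebra.algebraMap_eq_smul_one]
      ext v; simp
  · exfalso
    obtain ⟨p, hp, q, hq, hpq⟩ : ∃ p ∈ spectrum ℝ T, ∃ q ∈ spectrum ℝ T, p < q := by
      rw [Set.not_subsingleton_iff] at hs
      obtain ⟨p, hp, q, hq, hne⟩ := hs
      rcases lt_or_gt_of_ne hne with h | h
      exacts [⟨p, hp, q, hq, h⟩, ⟨q, hq, p, hp, h⟩]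
    -- Two spectral points would give nonzero `f(T)` and `g(T)` with product zero; the kernel of
    -- `f(T)` is then a nontrivial closed invariant subspace.
    let f : ℝ → ℝ := fun t => max (t - (p + q) / 2) 0
    let g : ℝ → ℝ := fun t => max ((p + q) / 2 - t) 0
    have hf : ContinuousOn f (spectrum ℝ T) := by fun_prop
    have hg : ContinuousOn g (spectrum ℝ T) := by fun_prop
    have hfg : cfc f T * cfc g T = 0 := by
      rw [← cfc_mul f g T, cfc_congr (g := fun _ => (0 : ℝ)), cfc_const_zero]
      intro t _
      simp only [f, g, mul_eq_zero]
      rcases le_total t ((p + q) / 2) with h | h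
      · left; exact max_eq_right (by linarith)
      · right; exact max_eq_right (by linarith)
    have hf0 : cfc f T ≠ 0 := by
      intro h
      have h1 : f q ∈ spectrum ℝ (cfc f T) := by
        rw [cfc_map_spectrum f T]; exact ⟨q, hq, rfl⟩
      rw [h] at h1
      have : f q = 0 := by
        by_contra hne
        exact h1 (by simpa [spectrum.mem_resolventSet_iff] using (IsUnit.mk0 _ hne).map (algebraMap ℝ (H →L[ℂ] H)))
      have h3 : f q = q - (p + q) / 2 := max_eq_left (by linarith)
      linarith
    have hg0 : cfc g T ≠ 0 := by
      intro h
      have h1 : g p ∈ spectrum ℝ (cfc g T) := by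
        rw [cfc_map_spectrum g T]; exact ⟨p, hp, rfl⟩
      rw [h] at h1
      have : g p = 0 := by
        by_contra hne
        exact h1 (by simpa [spectrum.mem_resolventSet_iff] using (IsUnit.mk0 _ hne).map (algebraMap ℝ (H →L[ℂ] H)))
      have h3 : g p = (p + q) / 2 - p := max_eq_left (by linarith)
      linarith
    have hcf : ∀ a, Commute (cfc f T) (π a) := fun a => (hc a).symm.cfc_real f
    rcases hπ.2 (LinearMap.ker (cfc f T).toLinearMap) (ContinuousLinearMap.isClosed_ker _)
      (fun a v hv => by
        have hv' : cfc f T v = 0 := hv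
        change cfc f T (π a v) = 0
        have h := congr($((hcf a).eq) v)
        rw [mul_apply_eq_comp, mul_apply_eq_comp, hv', map_zero] at h
        exact h) with h | h
    · refine hg0 (ContinuousLinearMap.ext fun v => ?_)
      have : cfc g T v ∈ LinearMap.ker (cfc f T).toLinearMap := by
        change (cfc f T * cfc g T) v = 0
        rw [hfg]; rfl
      rw [h] at this
      exact this
    · refine hf0 (ContinuousLinearMap.ext fun v => ?_)
      have : v ∈ LinearMap.ker (cfc f T).toLinearMap := h ▸ Submodule.mem_top
      exact this

/-- Schur's lemma. -/
theorem IsIrreducibleRep.exists_eq_smul_one (hπ : IsIrreducibleRep π)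
    {T : H →L[ℂ] H} (hc : ∀ a, Commute (π a) T) : ∃ c : ℂ, T = c • 1 := by
  have hc' : ∀ a, Commute (π a) (star T) := fun a => by
    have := (hc (star a)).star_star
    rwa [← map_star, star_star] at this
  obtain ⟨c, h₁⟩ := hπ.exists_eq_smul_one_of_isSelfAdjoint (realPart T).2 (fun a => by
    rw [realPart_apply_coe]; exact ((hc a).add_right (hc' a)).smul_right _)
  obtain ⟨d, h₂⟩ := hπ.exists_eq_smul_one_of_isSelfAdjoint (imaginaryPart T).2 (fun a => by
    rw [imaginaryPart_apply_coe]
    exact (((hc a).sub_right (hc' a)).smul_right _).smul_right _)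
  refine ⟨c + Complex.I * d, ?_⟩
  rw [← realPart_add_I_smul_imaginaryPart T, h₁, h₂, smul_smul, add_smul]

/-- The commutant of an irreducible representation is trivial, in the form needed for
approximation: a normal functional which vanishes on the range of the representation is zero. -/
theorem IsIrreducibleRep.sum_inner_eq_zero (hπ : IsIrreducibleRep π) {ι : Type*} [Fintype ι]
    (u w : ι → H) (h : ∀ a, ∑ j, ⟪u j, π a (w j)⟫_ℂ = 0) (S : H →L[ℂ] H) :
    ∑ j, ⟪u j, S (w j)⟫_ℂ = 0 := by
  classical
  let D : (H →L[ℂ] H) → (PiLp 2 (fun _ : ι => H) →L[ℂ] PiLp 2 (fun _ : ι => H)) := fun T =>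
    (PiLp.continuousLinearEquiv 2 ℂ (fun _ : ι => H)).symm.toContinuousLinearMap ∘L
      ContinuousLinearMap.pi (fun i => T ∘L PiLp.proj 2 (fun _ : ι => H) i)
  have hD : ∀ T z i, D T z i = T (z i) := fun T z i => rfl
  have hDstar : ∀ T, star (D T) = D (star T) := by
    intro T
    rw [ContinuousLinearMap.star_eq_adjoint]
    symm
    rw [ContinuousLinearMap.eq_adjoint_iff]
    intro x y
    simp [PiLp.inner_apply, hD, ContinuousLinearMap.star_eq_adjoint,
      ContinuousLinearMap.adjoint_inner_left]
  let W : PiLp 2 (fun _ : ι => H) := WithLp.toLp 2 w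
  let U : PiLp 2 (fun _ : ι => H) := WithLp.toLp 2 u
  let L : A →ₗ[ℂ] PiLp 2 (fun _ : ι => H) :=
    { toFun := fun a => D (π a) W
      map_add' := fun a b => by ext i; simp [hD]
      map_smul' := fun c a => by ext i; simp [hD] }
  let K := (LinearMap.range L).topologicalClosure
  have : CompleteSpace K := (Submodule.isClosed_topologicalClosure _).completeSpace_coe
  have hinv : ∀ a, ∀ z ∈ K, D (π a) z ∈ K := by
    intro a z hz
    refine map_mem_closure (D (π a)).continuous hz ?_
    rintro _ ⟨b, rfl⟩
    exact ⟨a * b, by ext i; simp [L, hD]⟩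
  set P := K.starProjection
  have hP : ∀ a z, P (D (π a) z) = D (π a) (P z) := fun a z =>
    starProjection_apply_comm K _ (hinv a) (by rw [hDstar, ← map_star]; exact hinv _) z
  have hsum : ∀ z : PiLp 2 (fun _ : ι => H), z = ∑ j, PiLp.single 2 j (z j) := by
    intro z; ext i; simp
  have hPS : ∀ z, P (D S z) = D S (P z) := by
    -- `P` commutes with the diagonal action, so its matrix entries commute with `π(A)` and are
    -- scalars by Schur. A scalar matrix commutes with every diagonal `D S`.
    have key : ∀ i j, ∃ c : ℂ, ∀ v : H, P (PiLp.single 2 j v) i = c • v := by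
      intro i j
      let T : H →L[ℂ] H := PiLp.proj 2 (fun _ : ι => H) i ∘L P ∘L
        (PiLp.continuousLinearEquiv 2 ℂ (fun _ : ι => H)).symm.toContinuousLinearMap ∘L
          ContinuousLinearMap.single ℂ (fun _ : ι => H) j
      have hT : ∀ v, T v = P (PiLp.single 2 j v) i := fun v => rfl
      obtain ⟨c, hc⟩ := hπ.exists_eq_smul_one (T := T) (fun a => by
        ext v
        change π a (T v) = T (π a v)
        rw [hT, hT, ← hD, ← hP]
        refine congrArg (fun z => P z i) (PiLp.ext fun l => ?_)
        rw [hD]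
        by_cases hl : l = j
        · subst hl; simp
        · simp [hl])
      exact ⟨c, fun v => by rw [← hT, hc]; rfl⟩
    choose c hc using key
    have hPc : ∀ z i, P z i = ∑ j, c i j • z j := by
      intro z i
      conv_lhs => rw [hsum z, map_sum]
      simp [hc]
    intro z
    ext i
    rw [hD, hPc, hPc, map_sum]
    simp [hD]
  -- Without a unit, `W` is not visibly in the orbit of `W`; nondegeneracy puts it in the closure.
  have hPW : P W = W := by
    have : W - P W = 0 := by
      ext i
      refine hπ.eq_zero_of_forall fun a => ?_
      have h1 : D (π a) (W - P W) = 0 := by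
        rw [map_sub, ← hP, sub_eq_zero]
        symm
        exact Submodule.starProjection_eq_self_iff.2 (subset_closure ⟨a, rfl⟩)
      rw [← hD, h1]; rfl
    exact (sub_eq_zero.1 this).symm
  have hPU : P U = 0 := by
    refine (Submodule.starProjection_apply_eq_zero_iff K).2 ?_
    rw [Submodule.orthogonal_closure]
    rintro _ ⟨a, rfl⟩
    rw [← inner_conj_symm, PiLp.inner_apply]
    exact (congrArg (starRingEnd ℂ) (h a)).trans (map_zero _)
  have : ⟪U, D S W⟫_ℂ = 0 := by
    rw [← hPW, ← hPS, ← Submodule.inner_starProjection_left_eq_right, hPU, inner_zero_left]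
  simpa [PiLp.inner_apply, hD, U, W] using this

/-- Self-adjoint operators are strongly approximated by self-adjoint elements of an irreducible
representation. -/
theorem IsIrreducibleRep.exists_isSelfAdjoint_norm_sub_lt (hπ : IsIrreducibleRep π) {ι : Type*}
    [Fintype ι] {S : H →L[ℂ] H} (hS : IsSelfAdjoint S) (w : ι → H) {ε : ℝ} (hε : 0 < ε) :
    ∃ a, IsSelfAdjoint a ∧ ∀ j, ‖π a (w j) - S (w j)‖ < ε := by
  let L : selfAdjoint A →ₗ[ℝ] PiLp 2 (fun _ : ι => H) :=
    { toFun := fun a => WithLp.toLp 2 fun j => π a (w j)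
      map_add' := fun a b => by ext i; simp
      map_smul' := fun c a => by
        ext i
        have : π ((c • a : selfAdjoint A) : A) = (c : ℂ) • π (a : A) := by
          rw [selfAdjoint.val_smul, ← map_smul, Complex.coe_smul]
        change π ((c • a : selfAdjoint A) : A) (w i) = _
        rw [this]
        simp }
  let W : PiLp 2 (fun _ : ι => H) := WithLp.toLp 2 fun j => S (w j)
  have hW : W ∈ closure (LinearMap.range L : Set (PiLp 2 (fun _ : ι => H))) := by
    by_contra hW
    obtain ⟨f, s, hf, hs⟩ := RCLike.geometric_hahn_banach_closed_point (𝕜 := ℂ)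
      (LinearMap.range L).convex.closure isClosed_closure hW
    have hf0 : ∀ a, (f (L a)).re = 0 := by
      have h0 : 0 < s := by simpa using hf 0 (subset_closure ⟨0, map_zero _⟩)
      intro a
      by_contra hne
      have h1 := hf (L ((s / (f (L a)).re) • a)) (subset_closure ⟨_, rfl⟩)
      rw [map_smul, ← Complex.coe_smul, map_smul] at h1
      simp [hne] at h1
    set u := (InnerProductSpace.toDual ℂ _).symm f
    have hu : ∀ z, f z = ∑ j, ⟪u j, z j⟫_ℂ := by
      intro z
      rw [← PiLp.inner_apply, InnerProductSpace.toDual_symm_apply]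
    -- The self-adjoint part is only a real subspace, so separation controls only the real part.
    -- Doubling the vectors turns twice that real part into a complex-linear expression in `a`, to
    -- which `sum_inner_eq_zero` applies.
    have key : ∀ a, IsSelfAdjoint a → ∑ j : ι ⊕ ι, ⟪Sum.elim u.ofLp w j, π a (Sum.elim w u.ofLp j)⟫_ℂ = 0 := by
      intro a ha
      have h1 := hf0 ⟨a, ha⟩
      rw [hu] at h1
      have h2 : ∀ j, ⟪w j, π a (u j)⟫_ℂ = (starRingEnd ℂ) ⟪u j, π a (w j)⟫_ℂ := by
        intro j
        rw [inner_conj_symm, ← ContinuousLinearMap.adjoint_inner_left,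
          ← ContinuousLinearMap.star_eq_adjoint, ← map_star, ha.star_eq]
      simp only [Fintype.sum_sum_type, Sum.elim_inl, Sum.elim_inr, h2]
      rw [← map_sum, Complex.add_conj]
      exact_mod_cast congrArg (2 * ·) h1 |>.trans (mul_zero _)
    have key2 := hπ.sum_inner_eq_zero (Sum.elim u.ofLp w) (Sum.elim w u.ofLp) (fun a => by
      rw [← realPart_add_I_smul_imaginaryPart a]
      simp only [map_add, map_smul, add_apply, smul_apply,
        inner_add_right, inner_smul_right, Finset.sum_add_distrib, ← Finset.mul_sum]
      rw [key _ (realPart a).2, key _ (imaginaryPart a).2]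
      simp) S
    have h2 : ∀ j, ⟪w j, S (u j)⟫_ℂ = (starRingEnd ℂ) ⟪u j, S (w j)⟫_ℂ := by
      intro j
      rw [inner_conj_symm, ← ContinuousLinearMap.adjoint_inner_left,
        ← ContinuousLinearMap.star_eq_adjoint, hS.star_eq]
    simp only [Fintype.sum_sum_type, Sum.elim_inl, Sum.elim_inr, h2] at key2
    rw [← map_sum, Complex.add_conj] at key2
    have h3 : (f W).re = 0 := by
      rw [hu]
      have : (2 : ℝ) * (∑ j, ⟪u j, S (w j)⟫_ℂ).re = 0 := by exact_mod_cast key2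
      simpa using this
    have h0 : 0 < s := by simpa using hf 0 (subset_closure ⟨0, map_zero _⟩)
    have h4 : s < (f W).re := hs
    linarith
  obtain ⟨_, ⟨a, rfl⟩, ha⟩ := Metric.mem_closure_iff.1 hW ε hε
  refine ⟨a, a.2, fun j => ?_⟩
  rw [dist_comm, dist_eq_norm] at ha
  exact (PiLp.norm_apply_le (L a - W) j).trans_lt ha

/-- **Kaplansky's density theorem** for an irreducible representation. -/
theorem IsIrreducibleRep.exists_norm_le_one_norm_sub_lt (hπ : IsIrreducibleRep π) {ι : Type*}
    [Fintype ι] {S : H →L[ℂ] H} (hS : IsSelfAdjoint S) (hS1 : ‖S‖ ≤ 1) (v : ι → H) {ε : ℝ}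
    (hε : 0 < ε) :
    ∃ a, IsSelfAdjoint a ∧ ‖a‖ ≤ 1 ∧ ∀ j, ‖π a (v j) - S (v j)‖ < ε := by
  let f : ℝ → ℝ := fun t => 2 * t * (1 + t ^ 2)⁻¹
  have hfc : Continuous f := by
    refine (by fun_prop : Continuous fun t : ℝ => 2 * t).mul (Continuous.inv₀ (by fun_prop) ?_)
    intro t
    positivity
  have hf0 : f 0 = 0 := by simp [f]
  have hf1 : ∀ t, ‖f t‖ ≤ 1 := by
    intro t
    rw [Real.norm_eq_abs, abs_le]
    have : 0 < 1 + t ^ 2 := by positivity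
    simp only [f, ← div_eq_mul_inv]
    rw [le_div_iff₀ this, div_le_iff₀ this]
    constructor <;> nlinarith [sq_nonneg (t + 1), sq_nonneg (t - 1)]
  obtain ⟨T, R, hTsa, hR, hSS⟩ := hS.exists_eq_two_mul_one_add_sq_inv hS1
  -- Here `S = 2T(1 + T²)⁻¹`. Approximating the possibly larger `T` and applying the bounded
  -- function `f` restores the norm bound; only the vectors `Rv` and `TRv` enter the error.
  obtain ⟨a, ha, hav⟩ := hπ.exists_isSelfAdjoint_norm_sub_lt hTsa
    (Sum.elim (fun j => R (v j)) fun j => T (R (v j))) (by positivity : 0 < ε / 3)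
  refine ⟨cfcₙ f a, cfcₙ_predicate f a, norm_cfcₙ_le (fun t _ => hf1 t), fun j => ?_⟩
  have hX : IsSelfAdjoint (π a) := ha.map π
  have hF : π (cfcₙ f a) = cfc f (π a) := by
    have hc : Continuous π :=
      (NonUnitalStarAlgHom.instContinuousLinearMapClassComplex.map_continuous π)
    rw [NonUnitalStarAlgHom.map_cfcₙ (R := ℝ) (S := ℂ) π f a hfc.continuousOn hf0 hc ha hX,
      cfcₙ_eq_cfc hfc.continuousOn hf0]
  rw [hF]
  have hFn : ‖cfc f (π a)‖ ≤ 1 := norm_cfc_le zero_le_one fun t _ => hf1 t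
  obtain ⟨Q, hQn, hQ, hFQ⟩ := hX.exists_cfc_eq_two_mul
  change cfc f (π a) = _ at hFQ
  set X := π a
  set F := cfc f X
  have e1 : v j = R (v j) + T (T (R (v j))) := congr($(hR) (v j)).symm
  have e2 : S (v j) = (2 : ℂ) • T (R (v j)) := congr($(hSS) (v j))
  have h1 := hav (Sum.inl j)
  have h2 := hav (Sum.inr j)
  simp only [Sum.elim_inl, Sum.elim_inr] at h1 h2
  set w := R (v j)
  have e3 : F (v j) - S (v j) = (2 : ℂ) • Q (X w - T w) - F (X (T w) - T (T w)) := by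
    have e4 : T w = Q (T w) + Q (X (X (T w))) := congr($(hQ) (T w)).symm
    have e5 : ∀ z, F z = (2 : ℂ) • Q (X z) := fun z => congr($(hFQ) z)
    rw [e2, e1, map_add, map_sub, map_sub, e5 w, e5 (X (T w))]
    linear_combination (norm := module) (-2 : ℂ) • e4
  rw [e3]
  have b1 : ‖Q (X w - T w)‖ ≤ ‖X w - T w‖ :=
    (Q.le_of_opNorm_le hQn _).trans_eq (one_mul _)
  have b2 : ‖F (X (T w) - T (T w))‖ ≤ ‖X (T w) - T (T w)‖ :=
    (F.le_of_opNorm_le hFn _).trans_eq (one_mul _)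
  calc _ ≤ ‖(2 : ℂ) • Q (X w - T w)‖ + ‖F (X (T w) - T (T w))‖ := norm_sub_le _ _
    _ = 2 * ‖Q (X w - T w)‖ + ‖F (X (T w) - T (T w))‖ := by rw [norm_smul]; simp
    _ < ε := by linarith

end Density

/-! ### Estimates for exponentials. -/

section Exp

open NormedSpace

variable {H : Type*} [NormedAddCommGroup H] [InnerProductSpace ℂ H] [CompleteSpace H]

theorem norm_exp_I_smul_apply {X : H →L[ℂ] H} (hX : IsSelfAdjoint X) (v : H) :
    ‖exp (Complex.I • X) v‖ = ‖v‖ := by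
  have h := (Unitary.mem_iff.1 (selfAdjoint.expUnitary ⟨X, hX⟩).2).1
  rw [selfAdjoint.expUnitary_coe] at h
  exact (ContinuousLinearMap.norm_map_iff_adjoint_comp_self _).2 h v

theorem hasDerivAt_exp_smul_apply (Z : H →L[ℂ] H) (v : H) (t : ℝ) :
    HasDerivAt (fun s : ℝ => exp (s • Z) v) (exp (t • Z) (Z v)) t :=
  ((ContinuousLinearMap.apply ℝ H v).comp
    (ContinuousLinearMap.restrictScalarsL ℂ H H ℝ ℝ)).hasFDerivAt.comp_hasDerivAt t
      (hasDerivAt_exp_smul_const (𝕂 := ℝ) Z t)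

/-- The curve `exp(itX)v` has constant speed `‖Xv‖`. Thus vectors nearly killed by `X` barely move,
however large `X` is. -/
theorem norm_exp_I_smul_apply_sub_le {X : H →L[ℂ] H} (hX : IsSelfAdjoint X) (v : H) :
    ‖exp (Complex.I • X) v - v‖ ≤ ‖X v‖ := by
  have := norm_image_sub_le_of_norm_deriv_le_segment_01' (C := ‖X v‖)
    (fun t _ => (hasDerivAt_exp_smul_apply (Complex.I • X) v t).hasDerivWithinAt) (fun t _ => by
      rw [smul_comm, norm_exp_I_smul_apply ((IsSelfAdjoint.all t).smul hX)]
      simp [norm_smul])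
  simpa using this

theorem norm_exp_I_smul_apply_sub_sub_le {X : H →L[ℂ] H} (hX : IsSelfAdjoint X) (v : H) :
    ‖exp (Complex.I • X) v - v - Complex.I • X v‖ ≤ ‖X‖ * ‖X v‖ := by
  have := norm_image_sub_le_of_norm_deriv_le_segment_01' (C := ‖X‖ * ‖X v‖)
    (f := fun t : ℝ => exp (t • (Complex.I • X)) v - t • Complex.I • X v)
    (fun t _ => ((hasDerivAt_exp_smul_apply (Complex.I • X) v t).sub
      ((hasDerivAt_id t).smul_const (Complex.I • X v))).hasDerivWithinAt) (fun t ht => by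
      have h := norm_exp_I_smul_apply_sub_le ((IsSelfAdjoint.all t).smul hX) ((Complex.I • X) v)
      rw [smul_comm, one_smul]
      refine h.trans ?_
      rw [smul_apply, norm_smul, smul_apply, map_smul, norm_smul, Complex.norm_I, one_mul,
        Real.norm_of_nonneg ht.1]
      calc t * ‖X (X v)‖ ≤ 1 * ‖X (X v)‖ := by gcongr; exact ht.2.le
        _ ≤ _ := by rw [one_mul]; exact X.le_opNorm _)
  refine le_trans (le_of_eq ?_) this
  simp [sub_right_comm]

/-- Since `exp(iπ) = -1`, `exp(iπX) = -exp(iπ(X - 1))`, and the previous estimate applies to `π(X -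
1)`. -/
theorem norm_exp_I_smul_pi_smul_apply_add_le {X : H →L[ℂ] H} (hX : IsSelfAdjoint X) (v : H) :
    ‖exp (Complex.I • Real.pi • X) v + v‖ ≤ Real.pi * ‖X v - v‖ := by
  have hY : IsSelfAdjoint (Real.pi • (X - 1)) := (IsSelfAdjoint.all _).smul (hX.sub (.one _))
  have h := norm_exp_I_smul_apply_sub_le hY v
  have e : exp (Complex.I • Real.pi • (X - 1)) = -exp (Complex.I • Real.pi • X) := by
    have e1 : Complex.I • Real.pi • (X - 1) = Complex.I • Real.pi • X +
        algebraMap ℂ (H →L[ℂ] H) (-(Real.pi * Complex.I)) := by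
      rw [Algebra.algebraMap_eq_smul_one, smul_sub, smul_sub, ← Complex.coe_smul Real.pi (1 : H →L[ℂ] H), smul_smul,
        neg_smul, mul_comm, sub_eq_add_neg]
    let +nondep : NormedAlgebra ℚ (H →L[ℂ] H) := .restrictScalars ℚ ℂ _
    rw [e1, exp_add_of_commute (Algebra.commutes _ _).symm, ← algebraMap_exp_comm,
      ← Complex.exp_eq_exp_ℂ, Complex.exp_neg, Complex.exp_pi_mul_I]
    simp
  rw [e] at h
  calc _ = ‖(-exp (Complex.I • Real.pi • X)) v - v‖ := by
        rw [← norm_neg]; congr 1; simp [sub_eq_add_neg, add_comm]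
    _ ≤ _ := h
    _ = _ := by rw [smul_apply, norm_smul, Real.norm_of_nonneg Real.pi_pos.le]; simp

/-- The curve `exp(ith) a exp(i(1 - t)h)` joins `a exp(ih)` to `exp(ih) a`; its derivative is `i[h,
a]` between two unitaries. -/
theorem norm_commutator_expUnitary_le {B : Type*} [CStarAlgebra B] (h : selfAdjoint B) (a : B) :
    ‖(selfAdjoint.expUnitary h : B) * a - a * selfAdjoint.expUnitary h‖ ≤ ‖(h : B) * a - a * h‖ := by
  set Z : B := Complex.I • (h : B) with hZ
  have hn : ∀ t : ℝ, exp (t • Z) = selfAdjoint.expUnitary (t • h) := by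
    intro t
    rw [selfAdjoint.expUnitary_coe, selfAdjoint.val_smul, smul_comm]
  have hd : ∀ t : ℝ, HasDerivAt (fun s : ℝ => exp (s • Z) * a * exp ((1 - s) • Z))
      (exp (t • Z) * (Z * a - a * Z) * exp ((1 - t) • Z)) t := by
    intro t
    have h1 := hasDerivAt_exp_smul_const (𝕂 := ℝ) Z t
    have h2 := (hasDerivAt_exp_smul_const' (𝕂 := ℝ) Z (1 - t)).scomp t
      ((hasDerivAt_id t).const_sub 1)
    convert (h1.mul_const a).mul h2 using 1
    · rfl
    · rw [neg_one_smul, Function.comp_apply]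
      noncomm_ring
  have := norm_image_sub_le_of_norm_deriv_le_segment_01' (C := ‖(h : B) * a - a * h‖)
    (fun t _ => (hd t).hasDerivWithinAt) (fun t _ => by
      rw [hn, hn, CStarRing.norm_mul_coe_unitary, CStarRing.norm_coe_unitary_mul, hZ,
        smul_mul_assoc, mul_smul_comm, ← smul_sub, norm_smul, Complex.norm_I, one_mul])
  simpa [hZ] using this

theorem norm_expUnitary_sub_one_le {B : Type*} [CStarAlgebra B] (h : selfAdjoint B)
    (hh : ‖h‖ ≤ Real.pi) : ‖(selfAdjoint.expUnitary h - 1 : B)‖ ≤ ‖h‖ := by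
  rw [← sq_le_sq₀ (norm_nonneg _) (norm_nonneg _), selfAdjoint.norm_sq_expUnitary_sub_one hh]
  linarith [Real.one_sub_sq_div_two_le_cos (x := ‖h‖)]

end Exp

/-! ### Quantitative Kadison transitivity. -/

section Transitivity

variable {A : Type*} [NonUnitalCStarAlgebra A]
  {H : Type*} [NormedAddCommGroup H] [InnerProductSpace ℂ H] [CompleteSpace H]
  {π : A →⋆ₙₐ[ℂ] (H →L[ℂ] H)}

theorem starLift_inr (π : A →⋆ₙₐ[ℂ] (H →L[ℂ] H)) (a : A) :
    Unitization.starLift π (a : Unitization ℂ A) = π a := by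
  simp only [Unitization.starLift_apply]
  exact Unitization.lift_symm_apply_apply (Unitization.lift π.toNonUnitalAlgHom) a |>.symm.trans
    (congr($(Unitization.lift.symm_apply_apply π.toNonUnitalAlgHom) a))

theorem norm_starLift_unitary_apply (π : A →⋆ₙₐ[ℂ] (H →L[ℂ] H)) (u : unitary (Unitization ℂ A))
    (v : H) : ‖Unitization.starLift π (u : Unitization ℂ A) v‖ = ‖v‖ := by
  refine (ContinuousLinearMap.norm_map_iff_adjoint_comp_self _).2 ?_ v
  have := congrArg (Unitization.starLift π) (Unitary.mem_iff.1 u.2).1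
  rwa [map_mul, map_star, map_one] at this

theorem starLift_expUnitary (π : A →⋆ₙₐ[ℂ] (H →L[ℂ] H)) (h : selfAdjoint (Unitization ℂ A)) :
    Unitization.starLift π (selfAdjoint.expUnitary h : Unitization ℂ A) =
      NormedSpace.exp (Complex.I • Unitization.starLift π (h : Unitization ℂ A)) := by
  let +nondep : NormedAlgebra ℚ (H →L[ℂ] H) := .restrictScalars ℚ ℂ _
  let +nondep : NormedAlgebra ℚ (Unitization ℂ A) := .restrictScalars ℚ ℂ _
  rw [selfAdjoint.expUnitary_coe, NormedSpace.map_exp, map_smul]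
  exact NonUnitalStarAlgHom.instContinuousLinearMapClassComplex.map_continuous
    (Unitization.starLift π)

/-- The self-adjoint element of the unitization given by a self-adjoint element. -/
def selfAdjointInr (a : A) (ha : IsSelfAdjoint a) : selfAdjoint (Unitization ℂ A) :=
  ⟨(a : Unitization ℂ A), ha.map (Unitization.inrNonUnitalStarAlgHom ℂ A)⟩

/-- An infinitesimal rotation which carries `ξ` to the unit vector `η` up to second order. -/
theorem exists_isSelfAdjoint_norm_add_I_smul_sub_le {ξ η : H} (hξ : ‖ξ‖ = 1) (hη : ‖η‖ = 1) :
    ∃ S : H →L[ℂ] H, IsSelfAdjoint S ∧ ‖S‖ ≤ 3 * ‖ξ - η‖ ∧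
      ‖ξ + Complex.I • S ξ - η‖ ≤ ‖ξ - η‖ ^ 2 := by
  obtain ⟨w, hwdef⟩ : ∃ w : H, w = -Complex.I • (η - ξ) := ⟨_, rfl⟩
  have hw : ‖w‖ = ‖ξ - η‖ := by
    rw [hwdef, norm_smul, norm_neg, Complex.norm_I, one_mul, norm_sub_rev]
  set c : ℝ := (⟪ξ, w⟫_ℂ).re
  have hc : |c| ≤ ‖ξ - η‖ := by
    refine (Complex.abs_re_le_norm _).trans ((norm_inner_le_norm _ _).trans ?_)
    rw [hξ, hw, one_mul]
  -- The ideal condition `iSξ = η - ξ`, that is `Sξ = w`, would force `⟪ξ, w⟫` to be real. This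
  -- self-adjoint `S` misses it only by the imaginary part of `⟪ξ, w⟫`, which is `‖ξ - η‖² / 2`.
  refine ⟨InnerProductSpace.rankOne ℂ w ξ + InnerProductSpace.rankOne ℂ ξ w -
    c • InnerProductSpace.rankOne ℂ ξ ξ, ?_, ?_, ?_⟩
  · rw [IsSelfAdjoint, ContinuousLinearMap.star_eq_adjoint]
    rw [map_sub, map_add, ← Complex.coe_smul, LinearIsometryEquiv.map_smulₛₗ]
    simp only [InnerProductSpace.adjoint_rankOne, Complex.conj_ofReal]
    rw [add_comm (InnerProductSpace.rankOne ℂ w ξ)]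
  · refine (norm_sub_le _ _).trans ?_
    have h1 := norm_add_le (InnerProductSpace.rankOne ℂ w ξ) (InnerProductSpace.rankOne ℂ ξ w)
    rw [InnerProductSpace.norm_rankOne, InnerProductSpace.norm_rankOne, hξ, hw] at h1
    rw [norm_smul, InnerProductSpace.norm_rankOne, hξ, Real.norm_eq_abs]
    linarith
  · have h1 : (⟪ξ, ξ⟫_ℂ) = 1 := by rw [inner_self_eq_norm_sq_to_K, hξ]; simp
    have h2 : ⟪w, ξ⟫_ℂ = (starRingEnd ℂ) ⟪ξ, w⟫_ℂ := (inner_conj_symm _ _).symm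
    have e1 : (InnerProductSpace.rankOne ℂ w ξ + InnerProductSpace.rankOne ℂ ξ w -
        c • InnerProductSpace.rankOne ℂ ξ ξ) ξ = w + (⟪w, ξ⟫_ℂ - c) • ξ := by
      rw [sub_apply, add_apply, smul_apply, InnerProductSpace.rankOne_apply,
        InnerProductSpace.rankOne_apply, InnerProductSpace.rankOne_apply, h1,
        ← Complex.coe_smul]
      module
    have e2 : Complex.I • w = η - ξ := by simp [hwdef, smul_smul]
    rw [e1, smul_add, e2]
    have e3 : ξ + (η - ξ + Complex.I • (⟪w, ξ⟫_ℂ - c) • ξ) - η =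
        Complex.I • (⟪w, ξ⟫_ℂ - c) • ξ := by abel
    rw [e3, norm_smul, norm_smul, hξ, Complex.norm_I, one_mul, mul_one]
    have e4 : ⟪w, ξ⟫_ℂ - c = -((⟪ξ, w⟫_ℂ).im : ℂ) * Complex.I := by
      rw [h2]
      apply Complex.ext
      · simp only [Complex.sub_re, Complex.conj_re, Complex.ofReal_re]; simp [c]
      · simp only [Complex.sub_im, Complex.conj_im, Complex.ofReal_im]; simp
    rw [e4, norm_mul, Complex.norm_I, mul_one, norm_neg, Complex.norm_real, Real.norm_eq_abs]
    have e5 : (⟪ξ, w⟫_ℂ).im = 1 - (⟪ξ, η⟫_ℂ).re := by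
      rw [hwdef, inner_smul_right, inner_sub_right, h1]
      simp
    have e6 : ‖ξ - η‖ ^ 2 = 2 * (1 - (⟪ξ, η⟫_ℂ).re) := by
      have := norm_sub_sq (𝕜 := ℂ) ξ η
      rw [hξ, hη] at this
      rw [this]
      change _ - 2 * (⟪ξ, η⟫_ℂ).re + _ = _
      ring
    have e7 : 0 ≤ 1 - (⟪ξ, η⟫_ℂ).re := by nlinarith [sq_nonneg ‖ξ - η‖]
    rw [e5, abs_of_nonneg e7, e6]
    linarith

/-- One step of the iteration in the proof of the transitivity theorem. -/
theorem IsIrreducibleRep.exists_unitary_norm_sub_le_half (hπ : IsIrreducibleRep π) {ξ η : H}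
    (hξ : ‖ξ‖ = 1) (hη : ‖η‖ = 1) (h : ‖ξ - η‖ ≤ 1 / 22) :
    ∃ u : unitary (Unitization ℂ A), ‖(u - 1 : Unitization ℂ A)‖ ≤ 3 * ‖ξ - η‖ ∧
      ‖Unitization.starLift π (u : Unitization ℂ A) ξ - η‖ ≤ ‖ξ - η‖ / 2 := by
  rcases (norm_nonneg (ξ - η)).eq_or_lt with h0 | h0
  · refine ⟨1, by simp, ?_⟩
    rw [← h0]
    simpa using h0.symm
  obtain ⟨S, hS, hSn, hSξ⟩ := exists_isSelfAdjoint_norm_add_I_smul_sub_le hξ hη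
  set d := ‖ξ - η‖
  have hd3 : 0 < 3 * d := by linarith
  obtain ⟨b, hb, hb1, hbξ⟩ := hπ.exists_norm_le_one_norm_sub_lt (S := (3 * d)⁻¹ • S)
    ((IsSelfAdjoint.all _).smul hS) (by
      rw [norm_smul, Real.norm_of_nonneg (by positivity), inv_mul_le_iff₀ hd3]
      linarith) (fun _ : Unit => ξ) (by positivity : 0 < d / 3)
  specialize hbξ ()
  have ha : IsSelfAdjoint ((3 * d) • b) := (IsSelfAdjoint.all _).smul hb
  set a := (3 * d) • b with hadef
  have han : ‖a‖ ≤ 3 * d := by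
    rw [hadef, norm_smul, Real.norm_of_nonneg hd3.le]
    exact mul_le_of_le_one_right hd3.le hb1
  have hπa : π a = (3 * d) • π b := by
    rw [hadef, ← Complex.coe_smul, map_smul, Complex.coe_smul]
  have haξ : ‖π a ξ - S ξ‖ ≤ d ^ 2 := by
    have e : π a ξ - S ξ = (3 * d) • (π b ξ - ((3 * d)⁻¹ • S) ξ) := by
      rw [hπa, smul_apply, smul_apply, smul_sub, smul_smul, mul_inv_cancel₀ hd3.ne', one_smul]
    rw [e, norm_smul, Real.norm_of_nonneg hd3.le]
    nlinarith
  have hn : ‖selfAdjointInr a ha‖ ≤ 3 * d := by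
    change ‖(a : Unitization ℂ A)‖ ≤ _
    rwa [Unitization.norm_inr]
  refine ⟨selfAdjoint.expUnitary (selfAdjointInr a ha),
    (norm_expUnitary_sub_one_le _ (hn.trans (by linarith [Real.pi_gt_three]))).trans hn, ?_⟩
  rw [starLift_expUnitary]
  change ‖NormedSpace.exp (Complex.I • Unitization.starLift π (a : Unitization ℂ A)) ξ - η‖ ≤ _
  rw [starLift_inr]
  have hX : IsSelfAdjoint (π a) := ha.map π
  have hXn : ‖π a‖ ≤ 3 * d := (NonUnitalStarAlgHom.norm_apply_le π a).trans han
  have h1 := norm_exp_I_smul_apply_sub_sub_le hX ξ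
  have h2 : ‖π a ξ‖ ≤ 3 * d := (π a).le_of_opNorm_le hXn ξ |>.trans_eq (by rw [hξ, mul_one])
  have h3 : ‖π a‖ * ‖π a ξ‖ ≤ 3 * d * (3 * d) := by gcongr
  have h4 : NormedSpace.exp (Complex.I • π a) ξ - η =
      (NormedSpace.exp (Complex.I • π a) ξ - ξ - Complex.I • π a ξ) + Complex.I • (π a ξ - S ξ) +
        (ξ + Complex.I • S ξ - η) := by
    rw [smul_sub]; abel
  rw [h4]
  have h5 : ‖Complex.I • (π a ξ - S ξ)‖ ≤ d ^ 2 := by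
    rwa [norm_smul, Complex.norm_I, one_mul]
  refine (norm_add₃_le).trans ?_
  -- The three errors are at most `9d²`, `d²` and `d²`; the sum `11d²` is at most `d / 2` because `d
  -- ≤ 1 / 22`.
  nlinarith

/-- A quantitative form of **Kadison's transitivity theorem** for a single vector. -/
theorem IsIrreducibleRep.exists_unitary_apply_eq (hπ : IsIrreducibleRep π) {ξ η : H}
    (hξ : ‖ξ‖ = 1) (hη : ‖η‖ = 1) (h : ‖ξ - η‖ ≤ 1 / 22) :
    ∃ u : unitary (Unitization ℂ A), ‖(u - 1 : Unitization ℂ A)‖ ≤ 6 * ‖ξ - η‖ ∧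
      Unitization.starLift π (u : Unitization ℂ A) ξ = η := by
  set ρ := Unitization.starLift π
  -- The smallness condition sits inside the existential so that `next` is a total function and can
  -- be iterated. Halving errors make the total displacement at most `3d(1 + 1/2 + …) = 6d`.
  have step : ∀ u : unitary (Unitization ℂ A), ∃ v : unitary (Unitization ℂ A),
      ‖ρ u ξ - η‖ ≤ 1 / 22 → ‖(v - u : Unitization ℂ A)‖ ≤ 3 * ‖ρ u ξ - η‖ ∧
        ‖ρ v ξ - η‖ ≤ ‖ρ u ξ - η‖ / 2 := by
    intro u
    by_cases hu : ‖ρ u ξ - η‖ ≤ 1 / 22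
    · obtain ⟨w, hw1, hw2⟩ := hπ.exists_unitary_norm_sub_le_half
        ((norm_starLift_unitary_apply π u ξ).trans hξ) hη hu
      refine ⟨w * u, fun _ => ⟨?_, ?_⟩⟩
      · have : ((w * u : unitary (Unitization ℂ A)) - u : Unitization ℂ A) =
            (w - 1 : Unitization ℂ A) * u := by simp [sub_mul]
        rw [this, CStarRing.norm_mul_coe_unitary]
        exact hw1
      · rw [Submonoid.coe_mul, map_mul]
        exact hw2
    · exact ⟨u, fun h => absurd h hu⟩
  choose next hnext using step
  let u : ℕ → unitary (Unitization ℂ A) := fun n => next^[n] 1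
  have hsucc : ∀ n, u (n + 1) = next (u n) := fun n => Function.iterate_succ_apply' _ _ _
  set d := ‖ξ - η‖
  have hd : 0 ≤ d := norm_nonneg _
  have hn : ∀ n, ‖ρ (u n) ξ - η‖ ≤ d / 2 ^ n ∧ ‖ρ (u n) ξ - η‖ ≤ 1 / 22 := by
    intro n
    induction n with
    | zero => exact ⟨by simp [u, d], by simpa [u] using! h⟩
    | succ n ih =>
      have h1 := (hnext (u n) ih.2).2
      rw [← hsucc] at h1
      refine ⟨?_, ?_⟩
      · rw [pow_succ, ← div_div]
        linarith [ih.1]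
      · linarith [ih.2, norm_nonneg (ρ (u n) ξ - η)]
  let U : ℕ → Unitization ℂ A := fun n => u n
  have hdist : ∀ n, dist (U n) (U (n + 1)) ≤ (6 * d) / 2 / 2 ^ n := by
    intro n
    have h1 := (hnext (u n) (hn n).2).1
    rw [← hsucc] at h1
    rw [dist_comm, dist_eq_norm]
    refine h1.trans ?_
    have := (hn n).1
    have e : 6 * d / 2 / 2 ^ n = 3 * (d / 2 ^ n) := by ring
    rw [e]
    linarith
  obtain ⟨v, hv⟩ := cauchySeq_tendsto_of_complete (cauchySeq_of_le_geometric_two hdist)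
  have hvu : v ∈ unitary (Unitization ℂ A) :=
    isClosed_unitary.mem_of_tendsto hv (Filter.Eventually.of_forall fun n => (u n).2)
  refine ⟨⟨v, hvu⟩, ?_, ?_⟩
  · have := dist_le_of_le_geometric_two_of_tendsto₀ hdist hv
    rw [dist_comm, dist_eq_norm] at this
    exact this
  · have hρ : Continuous ρ :=
      NonUnitalStarAlgHom.instContinuousLinearMapClassComplex.map_continuous ρ
    have h1 : Filter.Tendsto (fun n => ρ (U n) ξ) Filter.atTop (nhds (ρ v ξ)) :=
      (((ContinuousLinearMap.apply ℂ H ξ).continuous.comp hρ).tendsto v).comp hv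
    have h2 : Filter.Tendsto (fun n => ρ (U n) ξ) Filter.atTop (nhds η) := by
      rw [tendsto_iff_norm_sub_tendsto_zero]
      refine squeeze_zero (fun _ => norm_nonneg _) (fun n => (hn n).1) ?_
      exact tendsto_const_nhds.div_atTop (tendsto_pow_atTop_atTop_of_one_lt one_lt_two)
    exact tendsto_nhds_unique h1 h2

end Transitivity

/-! ### Glimm's lemma. -/

section Glimm

/-- An operator whose range meets a subspace of finite codimension trivially is compact. -/
theorem isCompactOperator_of_forall_inner_eq_zero {H : Type*} [NormedAddCommGroup H]
    [InnerProductSpace ℂ H] {ι : Type*} [Finite ι] (v : ι → H)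
    (T : H →L[ℂ] H) (h : ∀ u, (∀ j, ⟪v j, T u⟫_ℂ = 0) → T u = 0) : IsCompactOperator T := by
  have : Module.Finite ℂ (LinearMap.range T.toLinearMap) := by
    let L : LinearMap.range T.toLinearMap →ₗ[ℂ] (ι → ℂ) :=
      LinearMap.pi fun j => (innerSL ℂ (v j)).toLinearMap ∘ₗ Submodule.subtype _
    refine Module.Finite.of_injective L ((injective_iff_map_eq_zero L).2 ?_)
    rintro ⟨_, u, rfl⟩ hu
    exact Subtype.ext (h u fun j => congrFun hu j)
  let R := LinearMap.range T.toLinearMap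
  have : ProperSpace R := FiniteDimensional.proper ℂ R
  exact (((isCompactOperator_id (E := R)).comp_clm
    (T.codRestrict R fun u => ⟨u, rfl⟩)).clm_comp R.subtypeL)

variable {A : Type*} [NonUnitalCStarAlgebra A]
  {H : Type*} [NormedAddCommGroup H] [InnerProductSpace ℂ H] [CompleteSpace H]
  {π : A →⋆ₙₐ[ℂ] (H →L[ℂ] H)}

/-- If the image of `π` contains no compact operators then positive operators in the unitized image
which nearly annihilate a unit vector nearly annihilate a unit vector in any subspace of finite
codimension. -/
theorem IsIrreducibleRep.exists_norm_eq_one_inner_le (hπ : IsIrreducibleRep π)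
    (hK : ∀ a, IsCompactOperator (π a) → π a = 0) {c : Unitization ℂ A} (hc : IsSelfAdjoint c)
    (hC : 0 ≤ Unitization.starLift π c) {s : ℝ} (hs : 0 < s) {Ω : H} (hΩ : ‖Ω‖ = 1)
    (hΩc : (⟪Ω, Unitization.starLift π c Ω⟫_ℂ).re < s) {ι : Type*} [Finite ι] (v : ι → H) :
    ∃ ζ : H, ‖ζ‖ = 1 ∧ (∀ j, ⟪v j, ζ⟫_ℂ = 0) ∧
      (⟪ζ, Unitization.starLift π c ζ⟫_ℂ).re ≤ s := by
  -- `D = f(C)` maps into the spectral subspace where `C ≤ s`, and `1 - D ≤ C / s` keeps `DΩ`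
  -- nonzero.
  let f : ℝ → ℝ := fun t => max 0 (1 - s⁻¹ * t)
  have hf : Continuous f := by fun_prop
  have hfD : Unitization.starLift π (cfc f c) = cfc f (Unitization.starLift π c) :=
    StarAlgHom.map_cfc (R := ℝ) (S := ℂ) _ f c hf.continuousOn
      (NonUnitalStarAlgHom.instContinuousLinearMapClassComplex.map_continuous _) hc
      (hc.map (Unitization.starLift π))
  set C := Unitization.starLift π c with hCdef
  have hCsa : IsSelfAdjoint C := .of_nonneg hC
  set D := cfc f C with hD
  have hDsa : IsSelfAdjoint D := cfc_predicate f C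
  have hidC := cfc_id ℝ C
  have h1D : 1 - D ≤ s⁻¹ • C := by
    rw [hD, ← cfc_const_one ℝ C, ← cfc_sub (fun _ => 1) f C]
    nth_rw 2 [← hidC]
    rw [← cfc_smul s⁻¹ id C]
    refine cfc_mono fun t ht => ?_
    have := le_max_right 0 (1 - s⁻¹ * t)
    simp only [f, id, smul_eq_mul]
    linarith
  have hDCD : D * (C * D) ≤ s • (D * D) := by
    nth_rw 1 [← hidC]
    rw [hD, ← cfc_mul id f C, ← cfc_mul f _ C, ← cfc_mul f f C, ← cfc_smul s _ C]
    refine cfc_mono fun t ht => ?_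
    simp only [f, id, smul_eq_mul]
    rcases le_total t s with h | h
    · have : 0 ≤ max 0 (1 - s⁻¹ * t) := le_max_left _ _
      nlinarith [mul_nonneg this this]
    · have : max 0 (1 - s⁻¹ * t) = 0 := max_eq_left (by
        rw [sub_nonpos, ← div_eq_inv_mul, le_div_iff₀ hs]; linarith)
      simp [this]
  have hDΩ : D Ω ≠ 0 := by
    intro h
    have h1 := ((ContinuousLinearMap.le_def _ _).1 h1D).inner_nonneg_right Ω
    have h2 := (Complex.le_def.1 h1).1
    rw [sub_apply, sub_apply, h, one_apply_eq_self, smul_apply, sub_zero,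
      inner_sub_right, inner_self_eq_norm_sq_to_K, hΩ, ← Complex.coe_smul, inner_smul_right] at h2
    simp only [Complex.zero_re, Complex.sub_re, Complex.re_ofReal_mul] at h2
    have h3 : s⁻¹ * (⟪Ω, C Ω⟫_ℂ).re < 1 := by
      rw [inv_mul_lt_iff₀ hs, mul_one]; exact hΩc
    norm_num at h2
    linarith
  -- `D` comes only from the unitization; multiplying by `π y` brings it into `π(A)`, where the
  -- hypothesis on compact operators applies.
  obtain ⟨y, hy⟩ : ∃ y, D * π y ≠ 0 := by
    by_contra! h
    refine hDΩ (hπ.eq_zero_of_forall fun a => ?_)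
    have h1 := congrArg star (h (star a))
    rw [star_mul, ← map_star, star_star, hDsa.star_eq, star_zero] at h1
    exact congr($(h1) Ω)
  obtain ⟨z, hz⟩ : ∃ z, π z = D * π y := by
    refine ⟨(cfc f c * (y : Unitization ℂ A)).snd, ?_⟩
    have e : (((cfc f c * (y : Unitization ℂ A)).snd : A) : Unitization ℂ A) =
        cfc f c * (y : Unitization ℂ A) := by ext <;> simp
    rw [← starLift_inr, e, map_mul, hfD, starLift_inr]
  obtain ⟨u, hu, hu0⟩ : ∃ u, (∀ j, ⟪v j, (π z) u⟫_ℂ = 0) ∧ π z u ≠ 0 := by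
    by_contra! h
    exact hy (hz ▸ hK z (isCompactOperator_of_forall_inner_eq_zero v _ h))
  set w := π y u
  have hw : π z u = D w := by rw [hz]; rfl
  rw [hw] at hu0
  simp only [hw] at hu
  have hn : 0 < ‖D w‖ := norm_pos_iff.2 hu0
  have hle : (⟪D w, C (D w)⟫_ℂ).re ≤ s * ‖D w‖ ^ 2 := by
    have h1 := ((ContinuousLinearMap.le_def _ _).1 hDCD).inner_nonneg_right w
    have h2 := (Complex.le_def.1 h1).1
    have e : ∀ x, ⟪w, D x⟫_ℂ = ⟪D w, x⟫_ℂ := fun x => by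
      rw [← ContinuousLinearMap.adjoint_inner_left, ← ContinuousLinearMap.star_eq_adjoint,
        hDsa.star_eq]
    rw [sub_apply, smul_apply, inner_sub_right, ← Complex.coe_smul, inner_smul_right] at h2
    change (0 : ℂ).re ≤ ((s : ℂ) * ⟪w, D (D w)⟫_ℂ - ⟪w, D (C (D w))⟫_ℂ).re at h2
    rw [e, e, inner_self_eq_norm_sq_to_K, Complex.sub_re, Complex.re_ofReal_mul] at h2
    have e2 : (((‖D w‖ : ℂ)) ^ 2).re = ‖D w‖ ^ 2 := by norm_cast
    change _ ≤ s * (((‖D w‖ : ℂ)) ^ 2).re - _ at h2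
    rw [e2] at h2
    simpa using h2
  refine ⟨((‖D w‖⁻¹ : ℝ) : ℂ) • D w, ?_, fun j => ?_, ?_⟩
  · rw [norm_smul, Complex.norm_real, norm_inv, norm_norm, inv_mul_cancel₀ hn.ne']
  · rw [inner_smul_right, hu j, mul_zero]
  · rw [map_smul, inner_smul_left, inner_smul_right, Complex.conj_ofReal, Complex.re_ofReal_mul,
      Complex.re_ofReal_mul, ← mul_assoc, ← mul_inv, inv_mul_le_iff₀ (by positivity)]
    linarith

/-- **Glimm's lemma**, for pure states: if the image of `π` contains no compact operators, then
vector states are approximated by vector states of unit vectors in any given subspace of finite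
codimension. -/
theorem IsIrreducibleRep.exists_orthogonal_norm_sub_lt (hπ : IsIrreducibleRep π)
    (hK : ∀ a, IsCompactOperator (π a) → π a = 0) {Ω : H} (hΩ : ‖Ω‖ = 1)
    {κ : Type*} [Fintype κ] (x : κ → A) {ι : Type*} [Finite ι] (v : ι → H) {ε : ℝ} (hε : 0 < ε) :
    ∃ ζ : H, ‖ζ‖ = 1 ∧ (∀ j, ⟪v j, ζ⟫_ℂ = 0) ∧
      ∀ k, ‖⟪ζ, π (x k) ζ⟫_ℂ - ⟪Ω, π (x k) Ω⟫_ℂ‖ < ε := by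
  set ρ := Unitization.starLift π
  have hΩΩ : ⟪Ω, Ω⟫_ℂ = 1 := by rw [inner_self_eq_norm_sq_to_K, hΩ]; simp
  let y : κ → Unitization ℂ A := fun k => (x k : Unitization ℂ A) - ⟪Ω, π (x k) Ω⟫_ℂ • 1
  have hy : ∀ k w, ρ (y k) w = π (x k) w - ⟪Ω, π (x k) Ω⟫_ℂ • w := by
    intro k w
    simp only [y, map_sub, map_smul, map_one, ρ, starLift_inr]
    rfl
  have hyΩ : ∀ k, ⟪Ω, ρ (y k) Ω⟫_ℂ = 0 := by
    intro k
    rw [hy, inner_sub_right, inner_smul_right, hΩΩ, mul_one, sub_self]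
  let T : H →L[ℂ] H := 1 - InnerProductSpace.rankOne ℂ Ω Ω
  have hT : IsStarProjection T := by
    refine IsStarProjection.one_sub ⟨?_, ?_⟩
    · ext w
      change InnerProductSpace.rankOne ℂ Ω Ω (InnerProductSpace.rankOne ℂ Ω Ω w) = _
      rw [InnerProductSpace.rankOne_apply, InnerProductSpace.rankOne_apply, inner_smul_right, hΩΩ,
        mul_one]
    · rw [IsSelfAdjoint, ContinuousLinearMap.star_eq_adjoint, InnerProductSpace.adjoint_rankOne]
  have hTw : ∀ w, T w = w - ⟪Ω, w⟫_ℂ • Ω := fun w => rfl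
  set M : ℝ := ∑ k, (1 + ‖y k‖ ^ 2) + 1 with hM
  have hM1 : 1 ≤ M := by
    have : 0 ≤ ∑ k, (1 + ‖y k‖ ^ 2) := Finset.sum_nonneg fun k _ => by positivity
    linarith
  set τ := ε / 3 / M with hτdef
  have hτ : 0 < τ := by positivity
  obtain ⟨b, hb, -, hbv⟩ := hπ.exists_norm_le_one_norm_sub_lt hT.isSelfAdjoint hT.norm_le
    (fun k : Option κ => k.elim Ω fun k => ρ (y k) Ω) hτ
  have hbΩ : ‖π b Ω‖ ≤ τ := by
    have := (hbv none).le
    rwa [Option.elim_none, hTw, hΩΩ, one_smul, sub_self, sub_zero] at this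
  have hby : ∀ k, ‖ρ (y k) Ω - π b (ρ (y k) Ω)‖ ≤ τ := by
    intro k
    have := (hbv (some k)).le
    rwa [Option.elim_some, hTw, hyΩ, zero_smul, sub_zero, norm_sub_rev] at this
  -- An approximate form of `ker ω = L + L*`, with `L` the left kernel. As `b` imitates the
  -- projection onto `Ω⊥`, and `yΩ` is orthogonal to `Ω`, both `l₁` and `l₂` nearly kill `Ω`. Any
  -- unit vector nearly killed by all of them has nearly the same values on the `x k`.
  let l₁ : κ → Unitization ℂ A := fun k => (1 - (b : Unitization ℂ A)) * y k
  let l₂ : κ → Unitization ℂ A := fun k => star (y k) * b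
  have hbsa : IsSelfAdjoint (b : Unitization ℂ A) :=
    hb.map (Unitization.inrNonUnitalStarAlgHom ℂ A)
  have hl : ∀ k, l₁ k + star (l₂ k) = y k := by
    intro k
    simp only [l₁, l₂, star_mul, star_star, hbsa.star_eq]
    noncomm_ring
  have hl₁ : ∀ k, ‖ρ (l₁ k) Ω‖ ≤ τ := by
    intro k
    refine le_trans (le_of_eq ?_) (hby k)
    simp only [l₁, map_mul, map_sub, map_one, ρ, starLift_inr]
    rfl
  have hl₂ : ∀ k, ‖ρ (l₂ k) Ω‖ ≤ ‖y k‖ * τ := by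
    intro k
    have e : ρ (l₂ k) Ω = ρ (star (y k)) (π b Ω) := by
      simp only [l₂, map_mul, ρ, starLift_inr]
      rfl
    rw [e]
    refine ((ρ (star (y k))).le_opNorm _).trans ?_
    have := NonUnitalStarAlgHom.norm_apply_le ρ (star (y k))
    rw [norm_star] at this
    gcongr
  let c : Unitization ℂ A := ∑ k, (star (l₁ k) * l₁ k + star (l₂ k) * l₂ k)
  have hcsa : IsSelfAdjoint c := by
    refine isSelfAdjoint_sum _ fun k _ => (IsSelfAdjoint.star_mul_self _).add (.star_mul_self _)
  have hρc : ρ c = ∑ k, (star (ρ (l₁ k)) * ρ (l₁ k) + star (ρ (l₂ k)) * ρ (l₂ k)) := by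
    simp only [c, map_sum, map_add, map_mul, map_star]
  have hc0 : 0 ≤ ρ c := by
    rw [hρc]
    exact Finset.sum_nonneg fun k _ => add_nonneg (star_mul_self_nonneg _) (star_mul_self_nonneg _)
  have hsq : ∀ (S : H →L[ℂ] H) w, (⟪w, (star S * S) w⟫_ℂ).re = ‖S w‖ ^ 2 := by
    intro S w
    change (⟪w, star S (S w)⟫_ℂ).re = _
    rw [ContinuousLinearMap.star_eq_adjoint, ContinuousLinearMap.adjoint_inner_right,
      inner_self_eq_norm_sq_to_K]
    norm_cast
  have hcw : ∀ w, (⟪w, ρ c w⟫_ℂ).re = ∑ k, (‖ρ (l₁ k) w‖ ^ 2 + ‖ρ (l₂ k) w‖ ^ 2) := by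
    intro w
    rw [hρc, sum_apply, inner_sum, Complex.re_sum]
    refine Finset.sum_congr rfl fun k _ => ?_
    rw [add_apply, inner_add_right, Complex.add_re, hsq, hsq]
  have hcΩ : (⟪Ω, ρ c Ω⟫_ℂ).re < (ε / 3) ^ 2 := by
    rw [hcw]
    calc _ ≤ ∑ k, (1 + ‖y k‖ ^ 2) * τ ^ 2 := by
          refine Finset.sum_le_sum fun k _ => ?_
          have h1 : ‖ρ (l₁ k) Ω‖ ^ 2 ≤ τ ^ 2 := by gcongr; exact hl₁ k
          have h2 : ‖ρ (l₂ k) Ω‖ ^ 2 ≤ (‖y k‖ * τ) ^ 2 := by gcongr; exact hl₂ k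
          rw [mul_pow] at h2
          linarith
      _ = (M - 1) * τ ^ 2 := by rw [← Finset.sum_mul, hM]; ring
      _ < M * τ ^ 2 := by nlinarith [sq_pos_of_pos hτ]
      _ ≤ M * (M * τ ^ 2) := le_mul_of_one_le_left (by positivity) hM1
      _ = (ε / 3) ^ 2 := by
        have : M ≠ 0 := by positivity
        rw [hτdef]; field_simp
  obtain ⟨ζ, hζ, hζv, hζc⟩ := hπ.exists_norm_eq_one_inner_le hK hcsa hc0 (by positivity) hΩ hcΩ v
  refine ⟨ζ, hζ, hζv, fun k => ?_⟩
  have hζζ : ⟪ζ, ζ⟫_ℂ = 1 := by rw [inner_self_eq_norm_sq_to_K, hζ]; simp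
  change (⟪ζ, ρ c ζ⟫_ℂ).re ≤ _ at hζc
  rw [hcw] at hζc
  have hk := (Finset.single_le_sum (f := fun k => ‖ρ (l₁ k) ζ‖ ^ 2 + ‖ρ (l₂ k) ζ‖ ^ 2)
    (fun k _ => by positivity) (Finset.mem_univ k)).trans hζc
  have h1 : ‖ρ (l₁ k) ζ‖ ≤ ε / 3 := by
    rw [← sq_le_sq₀ (norm_nonneg _) (by positivity)]
    nlinarith [sq_nonneg ‖ρ (l₂ k) ζ‖]
  have h2 : ‖ρ (l₂ k) ζ‖ ≤ ε / 3 := by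
    rw [← sq_le_sq₀ (norm_nonneg _) (by positivity)]
    nlinarith [sq_nonneg ‖ρ (l₁ k) ζ‖]
  have e : ⟪ζ, π (x k) ζ⟫_ℂ - ⟪Ω, π (x k) Ω⟫_ℂ = ⟪ζ, ρ (l₁ k) ζ⟫_ℂ + ⟪ρ (l₂ k) ζ, ζ⟫_ℂ := by
    have e1 : ⟪ζ, ρ (y k) ζ⟫_ℂ = ⟪ζ, π (x k) ζ⟫_ℂ - ⟪Ω, π (x k) Ω⟫_ℂ := by
      rw [hy, inner_sub_right, inner_smul_right, hζζ, mul_one]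
    rw [← e1, ← hl k, map_add, add_apply, inner_add_right, map_star,
      ContinuousLinearMap.star_eq_adjoint, ContinuousLinearMap.adjoint_inner_right]
  rw [e]
  have h3 := norm_inner_le_norm (𝕜 := ℂ) ζ (ρ (l₁ k) ζ)
  have h4 := norm_inner_le_norm (𝕜 := ℂ) (ρ (l₂ k) ζ) ζ
  rw [hζ] at h3 h4
  refine (norm_add_le _ _).trans_lt ?_
  linarith

end Glimm

/-! ### Nearly swapping two vectors by `rowAd x h`. -/

/-- The resolvent of a positive element. -/
theorem exists_resolvent_of_nonneg {B : Type*} [CStarAlgebra B] [PartialOrder B] [StarOrderedRing B]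
    {K : B} (hK : 0 ≤ K) {s : ℝ} (hs : 0 < s) :
    ∃ R : B, ‖R‖ ≤ s⁻¹ ∧ K * R + s • R = 1 ∧ R * K = K * R ∧ IsSelfAdjoint (R * K) ∧
      ‖R * K‖ ≤ 1 := by
  have hKsa : IsSelfAdjoint K := .of_nonneg hK
  let f : ℝ → ℝ := fun t => (|t| + s)⁻¹
  have hf : Continuous f := Continuous.inv₀ (by fun_prop) fun t => by positivity
  have hRK : cfc (fun t => f t * id t) K = cfc f K * K := by
    conv_rhs => rw [← cfc_id ℝ K]
    rw [cfc_id ℝ K, cfc_mul f id K, cfc_id ℝ K]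
  have hKR : cfc (fun t => id t * f t) K = K * cfc f K := by
    rw [cfc_mul id f K, cfc_id ℝ K]
  have hcomm : cfc f K * K = K * cfc f K := by
    rw [← hRK, ← hKR]
    exact cfc_congr fun t _ => mul_comm _ _
  refine ⟨cfc f K, ?_, ?_, hcomm, hRK ▸ cfc_predicate _ K, hRK ▸ ?_⟩
  · refine norm_cfc_le (by positivity) fun t _ => ?_
    rw [Real.norm_of_nonneg (by positivity)]
    exact inv_anti₀ hs (by linarith [abs_nonneg t])
  · rw [← hKR, ← cfc_smul s f K, ← cfc_add K (fun t => id t * f t) (fun t => s • f t)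
      (continuous_id.mul hf).continuousOn (hf.const_smul s).continuousOn, ← cfc_const_one ℝ K]
    refine cfc_congr fun t ht => ?_
    have ht0 : 0 ≤ t := spectrum_nonneg_of_nonneg hK ht
    simp only [f, abs_of_nonneg ht0, smul_eq_mul, id]
    have : t + s ≠ 0 := by positivity
    field_simp
  · refine norm_cfc_le zero_le_one fun t _ => ?_
    rw [norm_mul, Real.norm_of_nonneg (by positivity), Real.norm_eq_abs,
      inv_mul_le_iff₀ (by positivity), id]
    linarith

section Swap

variable {A : Type*} [NonUnitalCStarAlgebra A]
  {H : Type*} [NormedAddCommGroup H] [InnerProductSpace ℂ H] [CompleteSpace H]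
  {π : A →⋆ₙₐ[ℂ] (H →L[ℂ] H)}

/-- A regularized orthogonal projection onto the span of finitely many vectors. -/
theorem exists_isSelfAdjoint_approx_projection {ι : Type*} [Fintype ι] (v : ι → H) {r : ℝ}
    (hr : 0 < r) :
    ∃ S : H →L[ℂ] H, IsSelfAdjoint S ∧ ‖S‖ ≤ 1 ∧ (∀ i, ‖S (v i) - v i‖ ≤ r) ∧
      ∀ w, ‖S w‖ ≤ (r ^ 2)⁻¹ * ∑ i, ‖⟪v i, w⟫_ℂ‖ * ‖v i‖ := by
  set s := r ^ 2
  have hs : 0 < s := by positivity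
  set K : H →L[ℂ] H := ∑ i, InnerProductSpace.rankOne ℂ (v i) (v i) with hKdef
  have hKw : ∀ w, K w = ∑ i, ⟪v i, w⟫_ℂ • v i := fun w => by
    rw [hKdef, sum_apply]
    rfl
  have hKsa : IsSelfAdjoint K := isSelfAdjoint_sum _ fun i _ => by
    rw [IsSelfAdjoint, ContinuousLinearMap.star_eq_adjoint, InnerProductSpace.adjoint_rankOne]
  have hKin : ∀ w, ⟪w, K w⟫_ℂ = ((∑ i, ‖⟪v i, w⟫_ℂ‖ ^ 2 : ℝ) : ℂ) := by
    intro w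
    rw [hKw, inner_sum, Complex.ofReal_sum]
    refine Finset.sum_congr rfl fun i _ => ?_
    rw [inner_smul_right, ← inner_conj_symm w (v i), Complex.mul_conj, Complex.normSq_eq_norm_sq]
  have hK0 : 0 ≤ K := by
    rw [ContinuousLinearMap.nonneg_iff_isPositive, ContinuousLinearMap.isPositive_iff']
    refine ⟨hKsa, fun w => ?_⟩
    rw [← ContinuousLinearMap.adjoint_inner_right, ← ContinuousLinearMap.star_eq_adjoint,
      hKsa.star_eq, hKin]
    exact_mod_cast Finset.sum_nonneg fun i _ => by positivity
  -- `S = (K + s)⁻¹K` replaces the projection onto the span: its bounds do not involve inverting the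
  -- Gram matrix of `v`, so the later `δ` can be uniform in the vectors.
  obtain ⟨R, hRn, hone, hcomm, hsa, hn⟩ := exists_resolvent_of_nonneg hK0 hs
  refine ⟨R * K, hsa, hn, fun i => ?_, fun w => ?_⟩
  · rw [hcomm]
    set y := R (v i)
    have e1 : K y + s • y = v i := congr($hone (v i))
    change ‖K y - v i‖ ≤ r
    have e2 : K y - v i = -(s • y) := by rw [← e1]; abel
    rw [e2, norm_neg, norm_smul, Real.norm_of_nonneg hs.le]
    have h1 : ⟪y, v i⟫_ℂ = ((∑ j, ‖⟪v j, y⟫_ℂ‖ ^ 2 + s * ‖y‖ ^ 2 : ℝ) : ℂ) := by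
      rw [← e1, inner_add_right, ← Complex.coe_smul, inner_smul_right, hKin,
        inner_self_eq_norm_sq_to_K]
      push_cast
      rfl
    have h2 : ‖⟪v i, y⟫_ℂ‖ ^ 2 ≤ ∑ j, ‖⟪v j, y⟫_ℂ‖ ^ 2 :=
      Finset.single_le_sum (f := fun j => ‖⟪v j, y⟫_ℂ‖ ^ 2) (fun j _ => by positivity)
        (Finset.mem_univ i)
    have h3 : ‖⟪v i, y⟫_ℂ‖ = ∑ j, ‖⟪v j, y⟫_ℂ‖ ^ 2 + s * ‖y‖ ^ 2 := by
      rw [norm_inner_symm, h1, Complex.norm_real, Real.norm_of_nonneg]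
      exact add_nonneg (Finset.sum_nonneg fun j _ => by positivity) (by positivity)
    -- With `p = ‖⟪v i, y⟫‖`, the preceding lines give `s‖y‖² ≤ p - p²`.
    have h4 : s * ‖y‖ ^ 2 ≤ 1 := by nlinarith [sq_nonneg (‖⟪v i, y⟫_ℂ‖ - 1)]
    rw [← sq_le_sq₀ (by positivity) hr.le]
    calc (s * ‖y‖) ^ 2 = s * (s * ‖y‖ ^ 2) := by ring
      _ ≤ s * 1 := by gcongr
      _ = r ^ 2 := mul_one _
  · change ‖R (K w)‖ ≤ _
    refine (R.le_of_opNorm_le hRn _).trans ?_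
    gcongr
    rw [hKw]
    refine (norm_sum_le _ _).trans_eq ?_
    simp only [norm_smul]

theorem IsSelfAdjoint.rowAd {n : ℕ} (x : Fin n → A) {h : A} (hh : IsSelfAdjoint h) :
    IsSelfAdjoint (rowAd x h) := by
  rw [rowAd_apply]
  exact isSelfAdjoint_sum _ fun i _ => hh.conjugate (x i)

/-- If two orthogonal vectors have the same Gram matrices along the row `x` up to a small error then
they are nearly interchanged by some `rowAd x h`. -/
theorem IsIrreducibleRep.exists_rowAd_swap (hπ : IsIrreducibleRep π) {n : ℕ} (x : Fin n → A)
    {ρ : ℝ} (hρ : 0 < ρ) :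
    ∃ δ : ℝ, 0 < δ ∧ ∀ η₁ η₂ : H, ‖η₁‖ = 1 → ‖η₂‖ = 1 →
      (∀ i j, ‖⟪η₁, π (x i * star (x j)) η₁⟫_ℂ - ⟪η₂, π (x i * star (x j)) η₂⟫_ℂ‖ ≤ δ) →
      (∀ i j, ‖⟪η₁, π (x i * star (x j)) η₂⟫_ℂ‖ ≤ δ) →
      ‖π (∑ i, x i * star (x i)) η₁ - η₁‖ ≤ ρ → ‖π (∑ i, x i * star (x i)) η₂ - η₂‖ ≤ ρ →
      ∃ h : A, IsSelfAdjoint h ∧ ‖h‖ ≤ 1 ∧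
        ‖π (rowAd x h) (η₁ - η₂) - (η₁ - η₂)‖ ≤ 3 * ρ ∧
        ‖π (rowAd x h) (η₁ + η₂)‖ ≤ 3 * ρ := by
  set c : ℝ := 1 + ∑ i, ‖x i‖ with hc
  have hxc : ∀ i, ‖x i‖ ≤ c := fun i =>
    (Finset.single_le_sum (f := fun i => ‖x i‖) (fun _ _ => norm_nonneg _)
      (Finset.mem_univ i)).trans (by linarith)
  have hc0 : 0 < c := by
    have : 0 ≤ ∑ i, ‖x i‖ := Finset.sum_nonneg fun _ _ => norm_nonneg _
    linarith
  set r := ρ / (2 * (n * c + 1)) with hr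
  have hr0 : 0 < r := by positivity
  have hnr : n * c * (r + r) ≤ ρ := by
    have : ρ = (n * c + 1) * (r + r) := by rw [hr]; field_simp; ring
    rw [this]
    gcongr
    linarith
  -- Chosen so that `‖S (w j)‖ ≤ r`, given inner products at most `3δ` and `‖v i‖ ≤ 2c`. It depends
  -- only on `x` and `ρ`.
  refine ⟨r ^ 2 * r / (6 * (n * c + 1)), by positivity, ?_⟩
  set δ := r ^ 2 * r / (6 * (n * c + 1)) with hδ
  have hδ0 : 0 < δ := by positivity
  have hnδ : (r ^ 2)⁻¹ * (n * (3 * δ * (2 * c))) ≤ r := by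
    rw [inv_mul_le_iff₀ (by positivity)]
    have : r ^ 2 * r = δ * (6 * (n * c + 1)) := by rw [hδ]; field_simp
    rw [this]
    nlinarith
  intro η₁ η₂ hη₁ hη₂ hgram hcross hx₁ hx₂
  have hπx : ∀ i, ‖π (x i)‖ ≤ c := fun i => (NonUnitalStarAlgHom.norm_apply_le π _).trans (hxc i)
  have hπx' : ∀ i, ‖π (star (x i))‖ ≤ c := fun i =>
    (NonUnitalStarAlgHom.norm_apply_le π _).trans ((norm_star _).trans_le (hxc i))
  set v : Fin n → H := fun i => π (star (x i)) (η₁ - η₂) with hv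
  set w : Fin n → H := fun i => π (star (x i)) (η₁ + η₂) with hw
  have hvn : ∀ i, ‖v i‖ ≤ 2 * c := by
    intro i
    refine ((π (star (x i))).le_of_opNorm_le (hπx' i) _).trans ?_
    have := norm_sub_le η₁ η₂
    rw [hη₁, hη₂] at this
    nlinarith
  have hvw : ∀ i j, ‖⟪v i, w j⟫_ℂ‖ ≤ 3 * δ := by
    intro i j
    have hX : ∀ a b : H, ⟪π (star (x i)) a, π (star (x j)) b⟫_ℂ =
        ⟪a, π (x i * star (x j)) b⟫_ℂ := by
      intro a b
      rw [map_star, ContinuousLinearMap.star_eq_adjoint, ContinuousLinearMap.adjoint_inner_left,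
        map_mul]
      rfl
    have hX' : ⟪η₂, π (x i * star (x j)) η₁⟫_ℂ =
        (starRingEnd ℂ) ⟪η₁, π (x j * star (x i)) η₂⟫_ℂ := by
      rw [inner_conj_symm, ← ContinuousLinearMap.adjoint_inner_right,
        ← ContinuousLinearMap.star_eq_adjoint, ← map_star, star_mul, star_star]
    have e : ⟪v i, w j⟫_ℂ =
        (⟪η₁, π (x i * star (x j)) η₁⟫_ℂ - ⟪η₂, π (x i * star (x j)) η₂⟫_ℂ) +
          ⟪η₁, π (x i * star (x j)) η₂⟫_ℂ +
            -((starRingEnd ℂ) ⟪η₁, π (x j * star (x i)) η₂⟫_ℂ) := by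
      rw [hv, hw]
      simp only
      rw [hX, map_add, inner_add_right, inner_sub_left, inner_sub_left, hX']
      ring
    rw [e]
    refine norm_add₃_le.trans ?_
    rw [norm_neg, RCLike.norm_conj]
    linarith [hgram i j, hcross i j, hcross j i]
  obtain ⟨S, hS, hS1, hSv, hSw⟩ := exists_isSelfAdjoint_approx_projection v hr0
  have hSw' : ∀ j, ‖S (w j)‖ ≤ r := by
    intro j
    refine (hSw _).trans (le_trans ?_ hnδ)
    gcongr
    calc _ ≤ ∑ i : Fin n, 3 * δ * (2 * c) := by
          refine Finset.sum_le_sum fun i _ => ?_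
          exact mul_le_mul (hvw i j) (hvn i) (norm_nonneg _) (by positivity)
      _ = _ := by rw [Finset.sum_const, Finset.card_univ, Fintype.card_fin, nsmul_eq_mul]
  obtain ⟨h, hh, hh1, hhv⟩ := hπ.exists_norm_le_one_norm_sub_lt hS hS1 (Sum.elim v w) hr0
  have hrow : ∀ z, π (rowAd x h) z = ∑ i, π (x i) (π h (π (star (x i)) z)) := by
    intro z
    rw [rowAd_apply, map_sum, sum_apply]
    refine Finset.sum_congr rfl fun i _ => ?_
    rw [map_mul, map_mul]
    rfl
  have hsumle : ∀ u : Fin n → H, (∀ i, ‖u i‖ ≤ r + r) → ‖∑ i, π (x i) (u i)‖ ≤ ρ := by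
    intro u hu
    refine le_trans ((norm_sum_le _ _).trans ?_) hnr
    calc _ ≤ ∑ i : Fin n, c * (r + r) := by
          refine Finset.sum_le_sum fun i _ => ((π (x i)).le_of_opNorm_le (hπx i) _).trans ?_
          gcongr
          exact hu i
      _ = _ := by
        rw [Finset.sum_const, Finset.card_univ, Fintype.card_fin, nsmul_eq_mul, mul_assoc]
  refine ⟨h, hh, hh1, ?_, ?_⟩
  · have e1 : π (rowAd x h) (η₁ - η₂) - (η₁ - η₂) =
        ∑ i, π (x i) (π h (v i) - v i) + ((π (∑ i, x i * star (x i)) η₁ - η₁) -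
          (π (∑ i, x i * star (x i)) η₂ - η₂)) := by
      have e2 : ∑ i, π (x i) (v i) = π (∑ i, x i * star (x i)) (η₁ - η₂) := by
        rw [map_sum, sum_apply]
        refine Finset.sum_congr rfl fun i _ => ?_
        rw [map_mul]
        rfl
      simp only [map_sub (π (x _)), Finset.sum_sub_distrib]
      rw [e2, hrow, map_sub (π (∑ i, x i * star (x i)))]
      abel
    rw [e1]
    have h1 := hsumle (fun i => π h (v i) - v i) fun i => by
      have h2 := (hhv (Sum.inl i)).le
      rw [Sum.elim_inl] at h2
      rw [← sub_add_sub_cancel _ (S (v i))]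
      exact norm_add_le_of_le h2 (hSv i)
    have h2 := norm_sub_le (π (∑ i, x i * star (x i)) η₁ - η₁) (π (∑ i, x i * star (x i)) η₂ - η₂)
    exact (norm_add_le _ _).trans (by linarith)
  · rw [hrow]
    refine (hsumle (fun i => π h (w i)) fun i => ?_).trans (by linarith)
    have h2 := (hhv (Sum.inr i)).le
    rw [Sum.elim_inr] at h2
    rw [← sub_add_cancel (π h (w i)) (S (w i))]
    exact norm_add_le_of_le h2 (hSw' i)

/-- The almost interchanged vectors are almost carried into each other by an element which almost
commutes with whatever almost commutes with the range of `rowAd x`. -/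
theorem IsIrreducibleRep.exists_exp_apply_sub_le (hπ : IsIrreducibleRep π) {n : ℕ} (x : Fin n → A)
    {ρ : ℝ} (hρ : 0 < ρ) :
    ∃ δ : ℝ, 0 < δ ∧ ∀ η₁ η₂ : H, ‖η₁‖ = 1 → ‖η₂‖ = 1 →
      (∀ i j, ‖⟪η₁, π (x i * star (x j)) η₁⟫_ℂ - ⟪η₂, π (x i * star (x j)) η₂⟫_ℂ‖ ≤ δ) →
      (∀ i j, ‖⟪η₁, π (x i * star (x j)) η₂⟫_ℂ‖ ≤ δ) →
      ‖π (∑ i, x i * star (x i)) η₁ - η₁‖ ≤ ρ → ‖π (∑ i, x i * star (x i)) η₂ - η₂‖ ≤ ρ →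
      ∃ k : A, IsSelfAdjoint k ∧
        (∀ a, ‖a * k - k * a‖ ≤ Real.pi * ‖(adMap a).comp (rowAd x)‖) ∧
        ‖NormedSpace.exp (Complex.I • π k) η₁ - η₂‖ ≤ 12 * ρ := by
  obtain ⟨δ, hδ, H⟩ := hπ.exists_rowAd_swap x hρ
  refine ⟨δ, hδ, fun η₁ η₂ hη₁ hη₂ hgram hcross hx₁ hx₂ => ?_⟩
  obtain ⟨h, hh, hh1, hm, hp⟩ := H η₁ η₂ hη₁ hη₂ hgram hcross hx₁ hx₂
  have hX : IsSelfAdjoint (π (rowAd x h)) := (hh.rowAd x).map π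
  refine ⟨Real.pi • rowAd x h, (IsSelfAdjoint.all _).smul (hh.rowAd x), fun a => ?_, ?_⟩
  · rw [smul_mul_assoc, mul_smul_comm, ← smul_sub, norm_smul, Real.norm_of_nonneg Real.pi_pos.le]
    gcongr
    exact ((adMap a).comp (rowAd x)).le_of_opNorm_le le_rfl h |>.trans
      (mul_le_of_le_one_right (norm_nonneg _) hh1)
  · have e : π (Real.pi • rowAd x h) = Real.pi • π (rowAd x h) := by
      rw [← Complex.coe_smul, map_smul, Complex.coe_smul]
    rw [e]
    have h1 := norm_exp_I_smul_pi_smul_apply_add_le hX (η₁ - η₂)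
    have h2 := norm_exp_I_smul_apply_sub_le ((IsSelfAdjoint.all Real.pi).smul hX) (η₁ + η₂)
    rw [smul_apply, norm_smul, Real.norm_of_nonneg Real.pi_pos.le] at h2
    set U := NormedSpace.exp (Complex.I • Real.pi • π (rowAd x h))
    -- `U` nearly negates the difference and nearly fixes the sum. Half of the error `6πρ` is below
    -- `12ρ` because `π ≤ 4`.
    have e2 : (2 : ℝ) • (U η₁ - η₂) =
        (U (η₁ - η₂) + (η₁ - η₂)) + (U (η₁ + η₂) - (η₁ + η₂)) := by
      rw [map_sub, map_add, two_smul]; abel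
    have h3 : ‖(2 : ℝ) • (U η₁ - η₂)‖ ≤ Real.pi * (3 * ρ) + Real.pi * (3 * ρ) := by
      rw [e2]
      refine norm_add_le_of_le (h1.trans ?_) (h2.trans ?_) <;> gcongr
    rw [norm_smul, Real.norm_of_nonneg zero_le_two] at h3
    nlinarith [Real.pi_le_four]

end Swap

/-! ### Vector functionals and irreducibility from purity. -/

section VectorFunctional

variable {A : Type*} [NonUnitalCStarAlgebra A]
  {H : Type*} [NormedAddCommGroup H] [InnerProductSpace ℂ H] [CompleteSpace H]

/-- The functional `a ↦ ⟪w, π a w⟫` on `A`. -/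
noncomputable def vectorFunctional (π : A →⋆ₙₐ[ℂ] (H →L[ℂ] H)) (w : H) : A →L[ℂ] ℂ :=
  LinearMap.mkContinuous
    { toFun := fun a => ⟪w, π a w⟫_ℂ
      map_add' := fun a b => by rw [map_add, add_apply, inner_add_right]
      map_smul' := fun c a => by
        rw [map_smul, smul_apply, inner_smul_right, smul_eq_mul, RingHom.id_apply] }
    (‖w‖ ^ 2) fun a => by
      change ‖⟪w, π a w⟫_ℂ‖ ≤ _
      refine (norm_inner_le_norm _ _).trans ?_
      have := (π a).le_of_opNorm_le (NonUnitalStarAlgHom.norm_apply_le π a) w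
      nlinarith [norm_nonneg w]

theorem vectorFunctional_apply (π : A →⋆ₙₐ[ℂ] (H →L[ℂ] H)) (w : H) (a : A) :
    vectorFunctional π w a = ⟪w, π a w⟫_ℂ := rfl

theorem norm_vectorFunctional_le (π : A →⋆ₙₐ[ℂ] (H →L[ℂ] H)) (w : H) :
    ‖vectorFunctional π w‖ ≤ ‖w‖ ^ 2 :=
  LinearMap.mkContinuous_norm_le _ (by positivity) _

theorem vectorFunctional_nonneg [PartialOrder A] [StarOrderedRing A]
    (π : A →⋆ₙₐ[ℂ] (H →L[ℂ] H)) (w : H) {a : A} (ha : 0 ≤ a) : 0 ≤ vectorFunctional π w a := by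
  obtain ⟨b, rfl⟩ := CStarAlgebra.nonneg_iff_eq_star_mul_self.1 ha
  rw [vectorFunctional_apply, map_mul, map_star]
  change 0 ≤ ⟪w, star (π b) (π b w)⟫_ℂ
  rw [ContinuousLinearMap.star_eq_adjoint, ContinuousLinearMap.adjoint_inner_right,
    inner_self_eq_norm_sq_to_K]
  change (0 : ℂ) ≤ ((‖π b w‖ : ℝ) : ℂ) ^ 2
  rw [← Complex.ofReal_pow]
  exact Complex.zero_le_real.2 (sq_nonneg _)

/-- A cyclic representation whose cyclic vector defines a pure state is irreducible. -/
theorem isIrreducibleRep_of_mem_extremePoints [PartialOrder A] [StarOrderedRing A]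
    {π : A →⋆ₙₐ[ℂ] (H →L[ℂ] H)} {Ω : H} (hΩ : ‖Ω‖ = 1)
    (hcyc : ∀ z, (∀ a, ⟪z, π a Ω⟫_ℂ = 0) → z = 0)
    (hpure : vectorFunctional π Ω ∈ Set.extremePoints ℝ (stateSpace A)) : IsIrreducibleRep π := by
  refine ⟨?_, fun K hK hKinv => ?_⟩
  · by_contra! h
    have : Ω = 0 := hcyc Ω fun a => by rw [h a, zero_apply, inner_zero_right]
    rw [this, norm_zero] at hΩ
    exact zero_ne_one hΩ
  have : CompleteSpace K := hK.completeSpace_coe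
  set P := K.starProjection
  have hP : ∀ a z, P (π a z) = π a (P z) := fun a z =>
    starProjection_apply_comm K _ (hKinv a) (by rw [← map_star]; exact hKinv _) z
  have hPP : ∀ z, P (P z) = P z := fun z =>
    Submodule.starProjection_eq_self_iff.2 (K.starProjection_apply_mem z)
  have hPsa : ∀ z w, ⟪P z, w⟫_ℂ = ⟪z, P w⟫_ℂ := fun z w =>
    Submodule.inner_starProjection_left_eq_right K z w
  set ξ := P Ω with hξ
  set ζ := Ω - P Ω with hζ
  have hdec : ∀ a, ⟪Ω, π a Ω⟫_ℂ = ⟪ξ, π a ξ⟫_ℂ + ⟪ζ, π a ζ⟫_ℂ := by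
    intro a
    have e1 : ⟪ξ, π a ξ⟫_ℂ = ⟪Ω, π a ξ⟫_ℂ := by
      rw [hξ, hPsa, hP, hPP]
    have e2 : ⟪P Ω, π a Ω⟫_ℂ = ⟪Ω, π a ξ⟫_ℂ := by
      rw [hPsa, hP]
    rw [hζ, map_sub, inner_sub_left, inner_sub_right, inner_sub_right, e2, ← hξ, e1]
    ring
  have hbot : ξ = 0 → K = ⊥ := by
    intro h0
    rw [Submodule.eq_bot_iff]
    intro z hz
    refine hcyc z fun a => ?_
    rw [← Submodule.starProjection_eq_self_iff.2 hz, hPsa, hP, ← hξ, h0, map_zero,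
      inner_zero_right]
  have htop : ζ = 0 → K = ⊤ := by
    intro h0
    rw [← Submodule.orthogonal_eq_bot_iff, Submodule.eq_bot_iff]
    intro z hz
    refine hcyc z fun a => ?_
    have e : π a Ω ∈ K := by
      rw [sub_eq_zero.1 h0]
      exact hKinv a _ (K.starProjection_apply_mem _)
    exact Submodule.inner_left_of_mem_orthogonal e hz
  by_cases hξ0 : ξ = 0
  · exact Or.inl (hbot hξ0)
  by_cases hζ0 : ζ = 0
  · exact Or.inr (htop hζ0)
  exfalso
  have hs : 0 < ‖ξ‖ ^ 2 := by have := norm_pos_iff.2 hξ0; positivity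
  have ht : 0 < ‖ζ‖ ^ 2 := by have := norm_pos_iff.2 hζ0; positivity
  have hst : ‖ξ‖ ^ 2 + ‖ζ‖ ^ 2 = 1 := by
    have h1 : ⟪ξ, ζ⟫_ℂ = 0 := by
      rw [hξ, hζ, hPsa, map_sub, hPP, sub_self, inner_zero_right]
    have h2 := norm_add_sq_eq_norm_sq_add_norm_sq_of_inner_eq_zero ξ ζ h1
    rw [hζ, hξ, add_sub_cancel, hΩ] at h2
    rw [hζ, hξ]
    nlinarith
  set f₁ : A →L[ℂ] ℂ := ((‖ξ‖ ^ 2)⁻¹ : ℝ) • vectorFunctional π ξ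
  set f₂ : A →L[ℂ] ℂ := ((‖ζ‖ ^ 2)⁻¹ : ℝ) • vectorFunctional π ζ
  have hcomb : ‖ξ‖ ^ 2 • f₁ + ‖ζ‖ ^ 2 • f₂ = vectorFunctional π Ω := by
    ext a
    simp only [f₁, f₂, smul_smul, mul_inv_cancel₀ hs.ne', mul_inv_cancel₀ ht.ne', one_smul]
    exact (hdec a).symm
  have hn₁ : ‖f₁‖ ≤ 1 := by
    rw [norm_smul, Real.norm_of_nonneg (by positivity), inv_mul_le_iff₀ hs, mul_one]
    exact norm_vectorFunctional_le π ξ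
  have hn₂ : ‖f₂‖ ≤ 1 := by
    rw [norm_smul, Real.norm_of_nonneg (by positivity), inv_mul_le_iff₀ ht, mul_one]
    exact norm_vectorFunctional_le π ζ
  -- A convex combination of functionals of norm at most one has norm one, so both have norm exactly
  -- one; no unit is needed.
  have hn : 1 ≤ ‖ξ‖ ^ 2 * ‖f₁‖ + ‖ζ‖ ^ 2 * ‖f₂‖ := by
    have h1 : ‖vectorFunctional π Ω‖ = 1 := hpure.1.2
    rw [← h1, ← hcomb]
    refine (norm_add_le _ _).trans_eq ?_
    rw [norm_smul (‖ξ‖ ^ 2) f₁, norm_smul (‖ζ‖ ^ 2) f₂, Real.norm_of_nonneg hs.le,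
      Real.norm_of_nonneg ht.le]
  have hf₁ : f₁ ∈ stateSpace A :=
    ⟨fun a ha => smul_nonneg (by positivity : (0 : ℝ) ≤ (‖ξ‖ ^ 2)⁻¹)
      (vectorFunctional_nonneg π ξ ha), by nlinarith⟩
  have hf₂ : f₂ ∈ stateSpace A :=
    ⟨fun a ha => smul_nonneg (by positivity : (0 : ℝ) ≤ (‖ζ‖ ^ 2)⁻¹)
      (vectorFunctional_nonneg π ζ ha), by nlinarith⟩
  have heq := (mem_extremePoints_iff_left.1 hpure).2 f₁ hf₁ f₂ hf₂ ⟨_, _, hs, ht, hst, hcomb⟩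
  -- Extremality and cyclicity give `PΩ = ‖ξ‖²Ω`. Applying `P` again forces `‖ξ‖² = 1`,
  -- contradicting `ζ ≠ 0`.
  have hvec : ξ - (‖ξ‖ ^ 2 : ℝ) • Ω = 0 := by
    refine hcyc _ fun a => ?_
    have h1 : ((‖ξ‖ ^ 2)⁻¹ : ℝ) • ⟪ξ, π a ξ⟫_ℂ = ⟪Ω, π a Ω⟫_ℂ := congr($heq a)
    have e1 : ⟪ξ, π a ξ⟫_ℂ = ⟪ξ, π a Ω⟫_ℂ := by
      rw [hξ, ← hP, ← hPsa, hPP]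
    rw [inner_sub_left, ← e1, ← Complex.coe_smul, inner_smul_left, Complex.conj_ofReal, ← h1,
      Complex.real_smul, ← mul_assoc, ← Complex.ofReal_mul, mul_inv_cancel₀ hs.ne',
      Complex.ofReal_one, one_mul, sub_self]
  have h2 : ξ = (‖ξ‖ ^ 2 : ℝ) • ξ := by
    have h3 := congrArg P hvec
    rw [map_sub, map_zero, ← Complex.coe_smul, map_smul, Complex.coe_smul, ← hξ, sub_eq_zero] at h3
    rwa [hξ, hPP, ← hξ] at h3
  have h3 : (1 - ‖ξ‖ ^ 2 : ℝ) • ξ = 0 := by rw [sub_smul, one_smul, ← h2, sub_self]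
  rcases smul_eq_zero.1 h3 with h | h
  · linarith
  · exact hξ0 h

end VectorFunctional

/-! ### The GNS representation of a pure state. -/

section GNS

variable {A : Type*} [NonUnitalCStarAlgebra A] [PartialOrder A] [StarOrderedRing A]

/-- Cauchy–Schwarz for `φ(ea)` along an approximate unit `e`. It makes `φ` bounded on the GNS space,
so that Riesz representation yields the cyclic vector without a unit. -/
theorem norm_apply_le_norm_toPreGNS (φ : A →ₚ[ℂ] ℂ) (hφ : ‖posFunctionalToCLM φ‖ ≤ 1) (a : A) :
    ‖φ a‖ ≤ ‖φ.toPreGNS a‖ := by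
  have hl := CStarAlgebra.increasingApproximateUnit A
  have h1 : Filter.Tendsto (fun e => ‖φ (e * a)‖) (CStarAlgebra.approximateUnit A)
      (nhds ‖φ a‖) :=
    (((posFunctionalToCLM φ).continuous.norm).tendsto a).comp (hl.tendsto_mul_right a)
  refine le_of_tendsto h1 ?_
  filter_upwards [hl.eventually_norm, hl.eventually_star_eq] with e he hse
  have h2 : ⟪φ.toPreGNS e, φ.toPreGNS a⟫_ℂ = φ (e * a) := by
    rw [PositiveLinearMap.preGNS_inner_def]
    simp [hse]
  rw [← h2]
  refine (norm_inner_le_norm _ _).trans (mul_le_of_le_one_left (norm_nonneg _) ?_)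
  rw [← sq_le_one_iff₀ (norm_nonneg _)]
  have h3 := PositiveLinearMap.preGNS_norm_sq φ (φ.toPreGNS e)
  have h4 : ‖φ (star e * e)‖ ≤ 1 := by
    refine ((posFunctionalToCLM φ).le_of_opNorm_le hφ _).trans ?_
    rw [one_mul, CStarRing.norm_star_mul_self]
    exact mul_le_one₀ he (norm_nonneg _) he
  have h5 : ‖((‖φ.toPreGNS e‖ ^ 2 : ℝ) : ℂ)‖ ≤ 1 := by
    rw [Complex.ofReal_pow, h3]
    exact h4
  rwa [Complex.norm_real, Real.norm_of_nonneg (by positivity)] at h5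

/-- The cyclic vector of the GNS representation of a state. -/
theorem exists_gns_cyclic_vector (φ : A →ₚ[ℂ] ℂ) (hφ : ‖posFunctionalToCLM φ‖ = 1) :
    ∃ Ω : φ.GNS, ‖Ω‖ = 1 ∧ (∀ a, φ a = ⟪Ω, φ.gnsNonUnitalStarAlgHom a Ω⟫_ℂ) ∧
      ∀ z, (∀ a, ⟪z, φ.gnsNonUnitalStarAlgHom a Ω⟫_ℂ = 0) → z = 0 := by
  let e : φ.PreGNS →ₗ[ℂ] φ.GNS := (UniformSpace.Completion.toComplL (𝕜 := ℂ)).toLinearMap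
  have he : DenseRange e := UniformSpace.Completion.denseRange_coe
  let F₀ : φ.PreGNS →ₗ[ℂ] ℂ := (posFunctionalToCLM φ).toLinearMap ∘ₗ φ.ofPreGNS.toLinearMap
  have hF₀ : ∀ x, ‖F₀ x‖ ≤ 1 * ‖e x‖ := by
    intro x
    rw [one_mul]
    refine (norm_apply_le_norm_toPreGNS φ hφ.le (φ.ofPreGNS x)).trans_eq ?_
    exact (UniformSpace.Completion.norm_coe _).symm
  let F := F₀.extendOfNorm e
  have hF : ∀ x, F (e x) = F₀ x := LinearMap.extendOfNorm_eq he ⟨1, hF₀⟩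
  have hFn : ‖F‖ ≤ 1 := LinearMap.opNorm_extendOfNorm_le he zero_le_one hF₀
  set Ω := (InnerProductSpace.toDual ℂ φ.GNS).symm F
  have hΩ : ∀ z, ⟪Ω, z⟫_ℂ = F z := fun z => InnerProductSpace.toDual_symm_apply
  have hin : ∀ a, ⟪Ω, (φ.toPreGNS a : φ.GNS)⟫_ℂ = φ a := fun a => (hΩ _).trans (hF _)
  have hπ : ∀ a, φ.gnsNonUnitalStarAlgHom a Ω = (φ.toPreGNS a : φ.GNS) := by
    intro a
    refine UniformSpace.Completion.denseRange_coe.eq_of_inner_left ℂ fun b => ?_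
    rw [← ContinuousLinearMap.adjoint_inner_right, ← ContinuousLinearMap.star_eq_adjoint,
      ← map_star, PositiveLinearMap.gnsNonUnitalStarAlgHom_apply_coe,
      UniformSpace.Completion.inner_coe, PositiveLinearMap.preGNS_inner_def]
    exact hin (star a * φ.ofPreGNS b)
  have hval : ∀ a, φ a = ⟪Ω, φ.gnsNonUnitalStarAlgHom a Ω⟫_ℂ := fun a => by rw [hπ, hin]
  refine ⟨Ω, le_antisymm ?_ ?_, hval, fun z hz => ?_⟩
  · rw [LinearIsometryEquiv.norm_map]
    exact hFn
  · have h1 : posFunctionalToCLM φ = vectorFunctional φ.gnsNonUnitalStarAlgHom Ω :=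
      ContinuousLinearMap.ext hval
    have h2 := norm_vectorFunctional_le φ.gnsNonUnitalStarAlgHom Ω
    rw [← h1, hφ] at h2
    exact (one_le_sq_iff₀ (norm_nonneg _)).1 h2
  · refine UniformSpace.Completion.denseRange_coe.eq_zero_of_inner_left ℂ fun b => ?_
    have := hz (φ.ofPreGNS b)
    rwa [hπ] at this

/-- The GNS representation of a pure state is irreducible, and the state is the vector state of
a unit vector. -/
theorem IsPureState.exists_vector {φ : A →ₚ[ℂ] ℂ} (hφ : IsPureState φ) :
    IsIrreducibleRep φ.gnsNonUnitalStarAlgHom ∧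
      ∃ Ω : φ.GNS, ‖Ω‖ = 1 ∧ ∀ a, φ a = ⟪Ω, φ.gnsNonUnitalStarAlgHom a Ω⟫_ℂ := by
  obtain ⟨Ω, hΩ, hval, hcyc⟩ := exists_gns_cyclic_vector φ hφ.1.2
  refine ⟨isIrreducibleRep_of_mem_extremePoints hΩ hcyc ?_, Ω, hΩ, hval⟩
  have h1 : posFunctionalToCLM φ = vectorFunctional φ.gnsNonUnitalStarAlgHom Ω :=
    ContinuousLinearMap.ext hval
  exact h1 ▸ hφ

end GNS

/-! ### Transfer of vector states under quasi-equivalence. -/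

section QuasiEquivalence

variable {A : Type*} [NonUnitalCStarAlgebra A]
  {H₁ : Type*} [NormedAddCommGroup H₁] [InnerProductSpace ℂ H₁] [CompleteSpace H₁]
  {H₂ : Type*} [NormedAddCommGroup H₂] [InnerProductSpace ℂ H₂] [CompleteSpace H₂]

/-- The commutant is scalar by Schur. This places rank-one projections in the domain of the
isomorphism `θ`. -/
theorem IsIrreducibleRep.mem_bicommutant {π : A →⋆ₙₐ[ℂ] (H₁ →L[ℂ] H₁)} (hπ : IsIrreducibleRep π)
    (T : H₁ →L[ℂ] H₁) : T ∈ bicommutant π := by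
  have key : ∀ g, (∀ a, Commute (π a) g) → g * T = T * g := by
    intro g hg
    obtain ⟨c, rfl⟩ := hπ.exists_eq_smul_one hg
    rw [smul_mul_assoc, mul_smul_comm, one_mul, mul_one]
  rw [bicommutant, StarSubalgebra.mem_centralizer_iff]
  intro g hg
  have hg' := (StarSubalgebra.mem_centralizer_iff ℂ).1 hg
  refine ⟨key g fun a => (hg' _ ⟨a, rfl⟩).1, key (star g) fun a => ?_⟩
  have h1 : Commute (star (π a)) g := (hg' _ ⟨a, rfl⟩).2
  simpa using h1.star_star

/-- Vector states of an irreducible representation are vector states of every quasi-equivalent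
representation. -/
theorem QuasiEquivalent.exists_vector {π₁ : A →⋆ₙₐ[ℂ] (H₁ →L[ℂ] H₁)}
    {π₂ : A →⋆ₙₐ[ℂ] (H₂ →L[ℂ] H₂)} (h : QuasiEquivalent π₁ π₂) (hπ : IsIrreducibleRep π₁) {Ω : H₁}
    (hΩ : ‖Ω‖ = 1) : ∃ η : H₂, ‖η‖ = 1 ∧ ∀ a, ⟪η, π₂ a η⟫_ℂ = ⟪Ω, π₁ a Ω⟫_ℂ := by
  obtain ⟨θ, hθ⟩ := h
  have hΩΩ : ⟪Ω, Ω⟫_ℂ = 1 := by rw [inner_self_eq_norm_sq_to_K, hΩ]; simp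
  let p : bicommutant π₁ := ⟨InnerProductSpace.rankOne ℂ Ω Ω, hπ.mem_bicommutant _⟩
  have hpsa : star p = p := Subtype.ext (by
    change star (InnerProductSpace.rankOne ℂ Ω Ω) = _
    rw [ContinuousLinearMap.star_eq_adjoint, InnerProductSpace.adjoint_rankOne])
  have hpp : p * p = p := Subtype.ext (ContinuousLinearMap.ext fun w => by
    change InnerProductSpace.rankOne ℂ Ω Ω (InnerProductSpace.rankOne ℂ Ω Ω w) =
      InnerProductSpace.rankOne ℂ Ω Ω w
    rw [InnerProductSpace.rankOne_apply, InnerProductSpace.rankOne_apply, inner_smul_right, hΩΩ,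
      mul_one])
  -- This purely algebraic identity survives `θ`, and makes every unit vector in the range of `θ p`
  -- implement the same state; no intertwining unitary is needed.
  have hpap : ∀ a, p * ⟨π₁ a, _root_.mem_bicommutant π₁ a⟩ * p = ⟪Ω, π₁ a Ω⟫_ℂ • p := fun a =>
    Subtype.ext (ContinuousLinearMap.ext fun w => by
      change InnerProductSpace.rankOne ℂ Ω Ω (π₁ a (InnerProductSpace.rankOne ℂ Ω Ω w)) =
        ⟪Ω, π₁ a Ω⟫_ℂ • InnerProductSpace.rankOne ℂ Ω Ω w
      rw [InnerProductSpace.rankOne_apply, InnerProductSpace.rankOne_apply, map_smul,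
        inner_smul_right, smul_smul, mul_comm])
  have hp0 : p ≠ 0 := by
    intro h0
    have h1 : InnerProductSpace.rankOne ℂ Ω Ω Ω = 0 := congr(($h0 : H₁ →L[ℂ] H₁) Ω)
    rw [InnerProductSpace.rankOne_apply, hΩΩ, one_smul] at h1
    rw [h1, norm_zero] at hΩ
    exact zero_ne_one hΩ
  set e : H₂ →L[ℂ] H₂ := (θ p).1 with he
  have hesa : star e = e := by
    have := congrArg (Subtype.val ∘ θ) hpsa
    simpa [map_star] using! this
  have hee : e * e = e := by
    have := congrArg (Subtype.val ∘ θ) hpp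
    simpa [map_mul] using! this
  have heae : ∀ a, e * π₂ a * e = ⟪Ω, π₁ a Ω⟫_ℂ • e := by
    intro a
    have := congrArg (Subtype.val ∘ θ) (hpap a)
    simpa [map_mul, map_smul, hθ] using! this
  have he0 : e ≠ 0 := by
    intro h0
    refine hp0 (θ.injective ?_)
    rw [map_zero]
    exact Subtype.ext h0
  obtain ⟨u, hu⟩ : ∃ u, e u ≠ 0 := by
    by_contra! h0
    exact he0 (ContinuousLinearMap.ext h0)
  have hn : ‖e u‖ ≠ 0 := norm_ne_zero_iff.2 hu
  set η : H₂ := ((‖e u‖⁻¹ : ℝ) : ℂ) • e u with hη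
  have hη1 : ‖η‖ = 1 := by
    rw [hη, norm_smul, Complex.norm_real, norm_inv, norm_norm, inv_mul_cancel₀ hn]
  have heη : e η = η := by
    rw [hη, map_smul]
    congr 1
    exact congr($hee u)
  refine ⟨η, hη1, fun a => ?_⟩
  have h1 : e (π₂ a η) = ⟪Ω, π₁ a Ω⟫_ℂ • η := by
    have h2 : e (π₂ a (e η)) = ⟪Ω, π₁ a Ω⟫_ℂ • e η := congr($(heae a) η)
    rwa [heη] at h2
  have h2 : ⟪η, π₂ a η⟫_ℂ = ⟪η, e (π₂ a η)⟫_ℂ := by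
    rw [← ContinuousLinearMap.adjoint_inner_left e, ← ContinuousLinearMap.star_eq_adjoint, hesa, heη]
  rw [h2, h1, inner_smul_right, inner_self_eq_norm_sq_to_K, hη1]
  simp

end QuasiEquivalence

/-! ### Paths of unitaries and their commutators. -/

section Paths

variable {B : Type*} [CStarAlgebra B]

theorem norm_commutator_unitary_mul_le (u v : unitary B) (a : B) :
    ‖((u * v : unitary B) : B) * a - a * (u * v : unitary B)‖ ≤
      ‖(u : B) * a - a * u‖ + ‖(v : B) * a - a * v‖ := by
  have e : ((u * v : unitary B) : B) * a - a * (u * v : unitary B) =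
      (u : B) * ((v : B) * a - a * v) + ((u : B) * a - a * u) * v := by
    rw [Submonoid.coe_mul]
    noncomm_ring
  rw [e]
  refine (norm_add_le _ _).trans_eq ?_
  rw [CStarRing.norm_coe_unitary_mul, CStarRing.norm_mul_coe_unitary, add_comm]

theorem norm_commutator_unitary_le (u : unitary B) (a : B) :
    ‖(u : B) * a - a * u‖ ≤ 2 * ‖(u - 1 : B)‖ * ‖a‖ := by
  have e : (u : B) * a - a * u = (u - 1 : B) * a - a * (u - 1 : B) := by noncomm_ring
  rw [e]
  refine (norm_sub_le _ _).trans ?_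
  linarith [norm_mul_le (u - 1 : B) a, norm_mul_le a (u - 1 : B)]

theorem norm_commutator_expUnitary_smul_le (k : selfAdjoint B) (a : B) {t : ℝ}
    (ht : t ∈ Set.Icc (0 : ℝ) 1) :
    ‖(selfAdjoint.expUnitary (t • k) : B) * a - a * selfAdjoint.expUnitary (t • k)‖ ≤
      ‖(k : B) * a - a * k‖ := by
  refine (norm_commutator_expUnitary_le (t • k) a).trans ?_
  rw [selfAdjoint.val_smul, smul_mul_assoc, mul_smul_comm, ← smul_sub, norm_smul,
    Real.norm_of_nonneg ht.1]
  exact mul_le_of_le_one_left (norm_nonneg _) ht.2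

/-- The path of unitaries through a product of three exponentials. -/
theorem exists_path_expUnitary_mul (a b c : selfAdjoint B) :
    ∃ u : C(unitInterval, unitary B), u 0 = 1 ∧
      u 1 = selfAdjoint.expUnitary a * (selfAdjoint.expUnitary b * selfAdjoint.expUnitary c) ∧
      ∀ t : unitInterval, u t = selfAdjoint.expUnitary ((t : ℝ) • a) *
        (selfAdjoint.expUnitary ((t : ℝ) • b) * selfAdjoint.expUnitary ((t : ℝ) • c)) := by
  have h0 : ∀ k : selfAdjoint B, selfAdjoint.expUnitary ((0 : ℝ) • k) = 1 := fun k => by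
    rw [show (0 : ℝ) • k = 0 from Subtype.ext (zero_smul ℝ (k : B)), selfAdjoint.expUnitary_zero]
  have h1 : ∀ k : selfAdjoint B, (1 : ℝ) • k = k := fun k => Subtype.ext (one_smul ℝ (k : B))
  have hc : ∀ k : selfAdjoint B, Continuous fun t : unitInterval =>
      selfAdjoint.expUnitary ((t : ℝ) • k) := fun k =>
    selfAdjoint.continuous_expUnitary.comp
      ((continuous_subtype_val.smul continuous_const).subtype_mk _ : Continuous
        fun t : unitInterval => (⟨(t : ℝ) • (k : B), ((t : ℝ) • k).2⟩ : selfAdjoint B))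
  refine ⟨⟨_, (hc a).mul ((hc b).mul (hc c))⟩, ?_, ?_, fun t => rfl⟩
  · change selfAdjoint.expUnitary ((0 : ℝ) • a) * (selfAdjoint.expUnitary ((0 : ℝ) • b) *
      selfAdjoint.expUnitary ((0 : ℝ) • c)) = 1
    rw [h0, h0, h0, one_mul, one_mul]
  · change selfAdjoint.expUnitary ((1 : ℝ) • a) * (selfAdjoint.expUnitary ((1 : ℝ) • b) *
      selfAdjoint.expUnitary ((1 : ℝ) • c)) = _
    rw [h1, h1, h1]

variable {A : Type*} [NonUnitalCStarAlgebra A]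

/-- The adjoint appears because `uΩ = η` makes the vector state of `η` equal to `ω ∘ Ad u*`. -/
theorem norm_unitaryAd_star_sub (u : unitary (Unitization ℂ A)) (a : A) :
    ‖unitaryAd (star u) a - a‖ =
      ‖(u : Unitization ℂ A) * (a : Unitization ℂ A) - (a : Unitization ℂ A) * u‖ := by
  have e : ((unitaryAd (star u) a - a : A) : Unitization ℂ A) =
      ((star u : unitary (Unitization ℂ A)) : Unitization ℂ A) *
        ((a : Unitization ℂ A) * u - (u : Unitization ℂ A) * (a : Unitization ℂ A)) := by
    rw [Unitization.inr_sub, coe_unitaryAd, Unitary.coe_star, star_star, mul_sub, ← mul_assoc,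
      ← mul_assoc (star (u : Unitization ℂ A)), Unitary.coe_star_mul_self, one_mul]
  rw [← Unitization.norm_inr (𝕜 := ℂ), e, CStarRing.norm_coe_unitary_mul, norm_sub_rev]

theorem inner_unitaryAd_star {H : Type*} [NormedAddCommGroup H] [InnerProductSpace ℂ H]
    [CompleteSpace H] (π : A →⋆ₙₐ[ℂ] (H →L[ℂ] H)) (u : unitary (Unitization ℂ A)) (a : A) (Ω : H) :
    ⟪Ω, π (unitaryAd (star u) a) Ω⟫_ℂ =
      ⟪Unitization.starLift π (u : Unitization ℂ A) Ω,
        π a (Unitization.starLift π (u : Unitization ℂ A) Ω)⟫_ℂ := by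
  rw [← starLift_inr, coe_unitaryAd, Unitary.coe_star, star_star, map_mul, map_mul, map_star,
    starLift_inr]
  change ⟪Ω, star (Unitization.starLift π (u : Unitization ℂ A))
    (π a (Unitization.starLift π (u : Unitization ℂ A) Ω))⟫_ℂ = _
  rw [ContinuousLinearMap.star_eq_adjoint, ContinuousLinearMap.adjoint_inner_right]

end Paths

/-! ### Assembling the path. -/

section Main

/-- A contraction nearly fixes the unit vectors at which its numerical range is nearly one. -/
theorem norm_apply_sub_le_of_norm_inner_sub_one_le {H : Type*} [NormedAddCommGroup H]
    [InnerProductSpace ℂ H] {T : H →L[ℂ] H} (hT : ‖T‖ ≤ 1) {z : H}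
    (hz : ‖z‖ = 1) {ρ : ℝ} (hρ : 0 ≤ ρ) (h : ‖⟪z, T z⟫_ℂ - 1‖ ≤ ρ ^ 2 / 2) : ‖T z - z‖ ≤ ρ := by
  have h1 : ‖T z‖ ≤ 1 := (T.le_of_opNorm_le hT z).trans_eq (by rw [hz, one_mul])
  have h2 := norm_sub_sq (𝕜 := ℂ) z (T z)
  have h3 : -(ρ ^ 2 / 2) ≤ (⟪z, T z⟫_ℂ - 1).re :=
    (abs_le.1 ((Complex.abs_re_le_norm _).trans h)).1
  rw [Complex.sub_re, Complex.one_re] at h3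
  change _ = _ - 2 * (⟪z, T z⟫_ℂ).re + _ at h2
  rw [← sq_le_sq₀ (norm_nonneg _) hρ, norm_sub_rev, h2, hz]
  nlinarith [norm_nonneg (T z)]

variable {A : Type*} [NonUnitalCStarAlgebra A]
  {H : Type*} [NormedAddCommGroup H] [InnerProductSpace ℂ H] [CompleteSpace H]
  {π : A →⋆ₙₐ[ℂ] (H →L[ℂ] H)}

/-- Vectors whose vector states are close along the row `x` are carried into each other by a path of
unitaries which almost commutes with `F`. -/
theorem IsIrreducibleRep.exists_unitary_path (hπ : IsIrreducibleRep π)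
    (hK : ∀ a, IsCompactOperator (π a) → π a = 0) {Ω : H} (hΩ : ‖Ω‖ = 1) (F : Finset A) {ε : ℝ}
    (hε : 0 < ε) {n : ℕ} (x : Fin n → A) (hx : ‖∑ i, x i * star (x i)‖ ≤ 1)
    (hxΩ : π (∑ i, x i * star (x i)) Ω = Ω)
    (hxF : ∀ a ∈ F, ‖(adMap a).comp (rowAd x)‖ < ε / 16) :
    ∃ δ : ℝ, 0 < δ ∧ ∀ η : H, ‖η‖ = 1 →
      (∀ i j, ‖⟪η, π (x i * star (x j)) η⟫_ℂ - ⟪Ω, π (x i * star (x j)) Ω⟫_ℂ‖ ≤ δ) →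
      ∃ u : C(unitInterval, unitary (Unitization ℂ A)), u 0 = 1 ∧
        Unitization.starLift π (u 1 : Unitization ℂ A) Ω = η ∧
        ∀ a ∈ F, ∀ t, ‖(u t : Unitization ℂ A) * (a : Unitization ℂ A) -
          (a : Unitization ℂ A) * u t‖ < ε := by
  set M : ℝ := 1 + ∑ a ∈ F, ‖a‖ with hM
  have hM0 : 1 ≤ M := by
    have : 0 ≤ ∑ a ∈ F, ‖a‖ := Finset.sum_nonneg fun _ _ => norm_nonneg _
    linarith
  have hFM : ∀ a ∈ F, ‖a‖ ≤ M := fun a ha =>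
    (Finset.single_le_sum (f := fun a => ‖a‖) (fun _ _ => norm_nonneg _) ha).trans (by linarith)
  -- Two swaps cost `12ρ` each, and `1 / 22` is the range of the transitivity theorem. The
  -- correcting unitary is within `6 · 24ρ = 144ρ` of 1, so its commutators are at most `288ρM`.
  obtain ⟨ρ, hρ, hρ1, hρ2⟩ : ∃ ρ : ℝ, 0 < ρ ∧ 24 * ρ ≤ 1 / 22 ∧ 288 * ρ * M ≤ ε / 4 := by
    refine ⟨min (1 / 528) (ε / (1152 * M)), by positivity, ?_, ?_⟩
    · linarith [min_le_left (1 / 528) (ε / (1152 * M))]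
    · have := min_le_right (1 / 528) (ε / (1152 * M))
      rw [le_div_iff₀ (by positivity)] at this
      linarith
  obtain ⟨δ₁, hδ₁, hswap⟩ := hπ.exists_exp_apply_sub_le x hρ
  -- `δ + δ` arises from comparing `ζ` with `η` through `Ω`; `nδ` from summing over the diagonal
  -- products `xᵢxᵢ*`.
  obtain ⟨δ, hδ, hδδ₁, hδρ⟩ : ∃ δ : ℝ, 0 < δ ∧ δ + δ ≤ δ₁ ∧ n * δ ≤ ρ ^ 2 / 2 := by
    refine ⟨min (δ₁ / 2) (ρ ^ 2 / (2 * (n + 1))), by positivity, ?_, ?_⟩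
    · linarith [min_le_left (δ₁ / 2) (ρ ^ 2 / (2 * ((n : ℝ) + 1)))]
    · have h1 := min_le_right (δ₁ / 2) (ρ ^ 2 / (2 * ((n : ℝ) + 1)))
      have h2 : 0 < min (δ₁ / 2) (ρ ^ 2 / (2 * ((n : ℝ) + 1))) := by positivity
      rw [le_div_iff₀ (by positivity)] at h1
      nlinarith
  have hΩΩ : ⟪Ω, Ω⟫_ℂ = 1 := by rw [inner_self_eq_norm_sq_to_K, hΩ]; simp
  have hfix : ∀ z : H, ‖z‖ = 1 →
      (∀ i j, ‖⟪z, π (x i * star (x j)) z⟫_ℂ - ⟪Ω, π (x i * star (x j)) Ω⟫_ℂ‖ ≤ δ) →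
      ‖π (∑ i, x i * star (x i)) z - z‖ ≤ ρ := by
    intro z hz h
    refine norm_apply_sub_le_of_norm_inner_sub_one_le
      ((NonUnitalStarAlgHom.norm_apply_le π _).trans hx) hz hρ.le (le_trans ?_ hδρ)
    have e : ⟪z, π (∑ i, x i * star (x i)) z⟫_ℂ - 1 =
        ∑ i, (⟪z, π (x i * star (x i)) z⟫_ℂ - ⟪Ω, π (x i * star (x i)) Ω⟫_ℂ) := by
      rw [Finset.sum_sub_distrib, ← inner_sum, ← inner_sum, ← sum_apply, ← sum_apply, ← map_sum,
        hxΩ, hΩΩ]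
    rw [e]
    refine (norm_sum_le _ _).trans ((Finset.sum_le_sum fun i _ => h i i).trans_eq ?_)
    rw [Finset.sum_const, Finset.card_univ, Fintype.card_fin, nsmul_eq_mul]
  refine ⟨δ, hδ, fun η hη hηδ => ?_⟩
  obtain ⟨ζ, hζ, hζv, hζδ⟩ := hπ.exists_orthogonal_norm_sub_lt hK hΩ
    (fun p : Fin n × Fin n => x p.1 * star (x p.2))
    (Sum.elim (fun p : Fin n × Fin n => star (π (x p.1 * star (x p.2))) Ω)
      fun p : Fin n × Fin n => π (x p.1 * star (x p.2)) η) hδ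
  have hζδ' : ∀ i j, ‖⟪ζ, π (x i * star (x j)) ζ⟫_ℂ - ⟪Ω, π (x i * star (x j)) Ω⟫_ℂ‖ ≤ δ :=
    fun i j => (hζδ (i, j)).le
  have hcross₁ : ∀ i j, ⟪Ω, π (x i * star (x j)) ζ⟫_ℂ = 0 := by
    intro i j
    have := hζv (Sum.inl (i, j))
    rwa [Sum.elim_inl, ContinuousLinearMap.star_eq_adjoint,
      ContinuousLinearMap.adjoint_inner_left] at this
  have hcross₂ : ∀ i j, ⟪ζ, π (x i * star (x j)) η⟫_ℂ = 0 := by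
    intro i j
    have := hζv (Sum.inr (i, j))
    rw [Sum.elim_inr] at this
    rw [← inner_conj_symm, this, map_zero]
  have hΩρ : ‖π (∑ i, x i * star (x i)) Ω - Ω‖ ≤ ρ := by rw [hxΩ, sub_self, norm_zero]; exact hρ.le
  obtain ⟨k₁, hk₁, hk₁F, hk₁Ω⟩ := hswap Ω ζ hΩ hζ
    (fun i j => by rw [norm_sub_rev]; linarith [hζδ' i j])
    (fun i j => by rw [hcross₁, norm_zero]; exact hδ₁.le) hΩρ (hfix ζ hζ hζδ')
  obtain ⟨k₂, hk₂, hk₂F, hk₂ζ⟩ := hswap ζ η hζ hη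
    (fun i j => by
      have := hηδ i j
      rw [norm_sub_rev] at this
      rw [← sub_add_sub_cancel _ ⟪Ω, π (x i * star (x j)) Ω⟫_ℂ]
      exact (norm_add_le_of_le (hζδ' i j) this).trans hδδ₁)
    (fun i j => by rw [hcross₂, norm_zero]; exact hδ₁.le) (hfix ζ hζ hζδ') (hfix η hη hηδ)
  set w₁ := selfAdjoint.expUnitary (selfAdjointInr k₁ hk₁) with hw₁
  set w₂ := selfAdjoint.expUnitary (selfAdjointInr k₂ hk₂) with hw₂
  have hρw₁ : Unitization.starLift π (w₁ : Unitization ℂ A) = NormedSpace.exp (Complex.I • π k₁) := by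
    rw [hw₁, starLift_expUnitary, ← starLift_inr]
    rfl
  have hρw₂ : Unitization.starLift π (w₂ : Unitization ℂ A) = NormedSpace.exp (Complex.I • π k₂) := by
    rw [hw₂, starLift_expUnitary, ← starLift_inr]
    rfl
  rw [← hρw₁] at hk₁Ω
  rw [← hρw₂] at hk₂ζ
  set σ := Unitization.starLift π
  have hclose : ‖σ w₂ (σ w₁ Ω) - η‖ ≤ 24 * ρ := by
    have e : σ w₂ (σ w₁ Ω) - η = σ w₂ (σ w₁ Ω - ζ) + (σ w₂ ζ - η) := by rw [map_sub]; abel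
    rw [e]
    refine (norm_add_le _ _).trans ?_
    rw [norm_starLift_unitary_apply]
    linarith
  obtain ⟨w₃, hw₃, hw₃η⟩ := hπ.exists_unitary_apply_eq
    (by rw [norm_starLift_unitary_apply, norm_starLift_unitary_apply, hΩ]) hη (hclose.trans hρ1)
  have hw₃ρ : ‖(w₃ - 1 : Unitization ℂ A)‖ ≤ 144 * ρ := hw₃.trans (by linarith)
  -- Below distance 2, `w₃` is the exponential of its principal argument, and the path to it stays
  -- within `‖w₃ - 1‖` of 1.
  have hw₃2 : ‖(w₃ - 1 : Unitization ℂ A)‖ < 2 := by linarith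
  obtain ⟨u, hu0, hu1, hut⟩ := exists_path_expUnitary_mul (Unitary.argSelfAdjoint w₃)
    (selfAdjointInr k₂ hk₂) (selfAdjointInr k₁ hk₁)
  refine ⟨u, hu0, ?_, fun a ha t => ?_⟩
  · rw [hu1, expUnitary_argSelfAdjoint hw₃2, Submonoid.coe_mul, Submonoid.coe_mul, map_mul,
      map_mul]
    exact hw₃η
  · have hkF : ∀ (k : A) (hk : IsSelfAdjoint k),
        ‖a * k - k * a‖ ≤ Real.pi * ‖(adMap a).comp (rowAd x)‖ →
        ‖(selfAdjoint.expUnitary ((t : ℝ) • selfAdjointInr k hk) : Unitization ℂ A) *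
          (a : Unitization ℂ A) - (a : Unitization ℂ A) *
            selfAdjoint.expUnitary ((t : ℝ) • selfAdjointInr k hk)‖ ≤ ε / 4 := by
      intro k hk h
      refine (norm_commutator_expUnitary_smul_le _ _ t.2).trans ?_
      change ‖(k : Unitization ℂ A) * (a : Unitization ℂ A) -
        (a : Unitization ℂ A) * (k : Unitization ℂ A)‖ ≤ _
      rw [← Unitization.inr_mul, ← Unitization.inr_mul, ← Unitization.inr_sub,
        Unitization.norm_inr, norm_sub_rev]
      -- `π · ε / 16 ≤ ε / 4`. Each of the three factors thus costs at most `ε / 4`.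
      nlinarith [hxF a ha, Real.pi_le_four, Real.pi_pos, norm_nonneg ((adMap a).comp (rowAd x))]
    rw [hut]
    refine (norm_commutator_unitary_mul_le _ _ _).trans_lt ?_
    have h₂₁ := norm_commutator_unitary_mul_le
      (selfAdjoint.expUnitary ((t : ℝ) • selfAdjointInr k₂ hk₂))
      (selfAdjoint.expUnitary ((t : ℝ) • selfAdjointInr k₁ hk₁)) (a : Unitization ℂ A)
    have h₁ := hkF k₁ hk₁ (hk₁F a)
    have h₂ := hkF k₂ hk₂ (hk₂F a)
    have h₃ := norm_commutator_unitary_le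
      (selfAdjoint.expUnitary ((t : ℝ) • Unitary.argSelfAdjoint w₃)) (a : Unitization ℂ A)
    have h₄ := (Unitary.norm_expUnitary_smul_argSelfAdjoint_sub_one_le w₃ t.2 hw₃2).trans hw₃ρ
    rw [Unitization.norm_inr] at h₃
    have h₅ : 2 * ‖(selfAdjoint.expUnitary ((t : ℝ) • Unitary.argSelfAdjoint w₃) - 1 :
        Unitization ℂ A)‖ * ‖a‖ ≤ 2 * (144 * ρ) * M := by
      gcongr
      exact hFM a ha
    linarith

end Main

/-- Every C⋆-algebra (unital or not) with Property B has Property A. -/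
theorem theorem3p1 {A : Type*} [NonUnitalCStarAlgebra A] [PartialOrder A] [StarOrderedRing A]
    (hB : PropertyB A) : PropertyA A := by
  classical
  intro F ω hω hK ε hε
  obtain ⟨hπ, Ω, hΩ, hval⟩ := hω.exists_vector
  have hΩΩ : inner ℂ Ω Ω = 1 := by rw [inner_self_eq_norm_sq_to_K, hΩ]; simp
  have hE : IsStarProjection (InnerProductSpace.rankOne ℂ Ω Ω) := by
    refine ⟨ContinuousLinearMap.ext fun w => ?_, ?_⟩
    · change InnerProductSpace.rankOne ℂ Ω Ω (InnerProductSpace.rankOne ℂ Ω Ω w) = _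
      rw [InnerProductSpace.rankOne_apply, InnerProductSpace.rankOne_apply, inner_smul_right, hΩΩ,
        mul_one]
    · rw [IsSelfAdjoint, ContinuousLinearMap.star_eq_adjoint, InnerProductSpace.adjoint_rankOne]
  have hEfin : FiniteDimensional ℂ (InnerProductSpace.rankOne ℂ Ω Ω).range := by
    refine Submodule.finiteDimensional_of_le (S₂ := Submodule.span ℂ {Ω}) ?_
    rintro _ ⟨w, rfl⟩
    exact Submodule.smul_mem _ _ (Submodule.mem_span_singleton_self Ω)
  obtain ⟨n, x, hx, hxE, hxF⟩ := hB F ω.GNS ω.gnsNonUnitalStarAlgHom hπ _ hE hEfin (ε / 16)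
    (by positivity)
  have hxΩ : ω.gnsNonUnitalStarAlgHom (∑ i, x i * star (x i)) Ω = Ω := by
    have h := congr($hxE Ω)
    change ω.gnsNonUnitalStarAlgHom _ (InnerProductSpace.rankOne ℂ Ω Ω Ω) = _ at h
    rwa [InnerProductSpace.rankOne_apply, hΩΩ, one_smul] at h
  obtain ⟨δ, hδ, hpath⟩ := hπ.exists_unitary_path hK hΩ F hε x hx hxΩ hxF
  refine ⟨Finset.univ.image fun p : Fin n × Fin n => x p.1 * star (x p.2), δ, hδ,
    fun φ hφ hq hclose => ?_⟩
  obtain ⟨hπφ, ξ, hξ, hvalφ⟩ := hφ.exists_vector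
  obtain ⟨η, hη, hηval⟩ := hq.exists_vector hπφ hξ
  obtain ⟨u, hu0, hu1, huF⟩ := hpath η hη fun i j => by
    rw [hηval, ← hvalφ, ← hval]
    exact (hclose _ (Finset.mem_image_of_mem (fun p : Fin n × Fin n => x p.1 * star (x p.2))
      (Finset.mem_univ (i, j)))).le
  refine ⟨⟨fun t => star (u t), continuous_star.comp u.continuous⟩, ?_, fun a => ?_,
    fun a ha t => ?_⟩
  · change star (u 0) = 1
    rw [hu0, star_one]
  · change φ a = ω (unitaryAd (star (u 1)) a)
    rw [hval, inner_unitaryAd_star, hu1, hηval, ← hvalφ]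
  · change ‖unitaryAd (star (u t)) a - a‖ < ε
    rw [norm_unitaryAd_star_sub]
    exact huF a ha t
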